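/- Let $M$ be a compact connected complex manifold. Let $\mathbb P(T_M)\to M$ be the bundle of lines in the holomorphic tangent spaces $T_pM$, and let $\mathcal O_{T^*_M}(-1)$ be the tautological line bundle on $\mathbb P(T_M)$, whose fibre over $(p,\ell)$, $\ell\subset T_pM$, is the line $\ell$. Suppose that $\mathcal O_{T^*_M}(-1)$ is RC-positive, i.e. it admits a smooth Hermitian metric whose Chern curvature $-\sqrt{-1}\,\partial\bar\partial\log|s|^2$ ($s$ a local nowhere vanishing holomorphic section) has at least one positive eigenvalue at every point of $\mathbb P(T_M)$. Let $(N,g)$ be a Kähler manifold whose underlying Riemannian metric has non-positive sectional curvature. Let $f:M\to N$ be a smooth map that is pluri-harmonic with respect to the Chern connection, i.e. $\partial_{\mathcal E}\bar\partial f=0$ for $\mathcal E=f^*(T^{1,0}N)$; in local holomorphic coordinates $z^\alpha$ on $M$ and $w^i$ on $N$ this means $$\frac{\partial^2 f^i}{\partial z^\alpha\partial\bar z^\beta}+\sum_{j,k}\Gamma^i_{jk}(f)\,\frac{\partial f^j}{\partial z^\alpha}\frac{\partial f^k}{\partial\bar z^\beta}=0\quad\text{for all } \alpha,\beta,i,\qquad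 \Gamma^i_{jk}=\sum_{\ell} g^{i\bar\ell}\,\frac{\partial g_{k\bar\ell}}{\partial w^j}.$$ Then $f$ is a constant map. -/

import Mathlib

open scoped Manifold ContDiff LinearAlgebra.Projectivization

noncomputable section

namespace KahlerRigidity

/-- The model space `ℂⁿ` of complex `n`-dimensional manifolds. -/
abbrev CSpace (n : ℕ) : Type := EuclideanSpace ℂ (Fin n)

/-! ### Wirtinger derivatives -/

section Wirtinger

variable {V : Type*} [NormedAddCommGroup V] [NormedSpace ℂ V]

/-- `∂_v g = ½ (D_v g - √-1 D_{√-1 v} g)`, where `D` is the real derivative.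
For `v` the `α`-th coordinate vector of `ℂᵐ` this is `∂g/∂z^α`. -/
def dz (g : V → ℂ) (x v : V) : ℂ :=
  (1 / 2) * (fderiv ℝ g x v - Complex.I * fderiv ℝ g x (Complex.I • v))

/-- `∂̄_v g = ½ (D_v g + √-1 D_{√-1 v} g)`.
For `v` the `β`-th coordinate vector of `ℂᵐ` this is `∂g/∂z̄^β`. -/
def dzbar (g : V → ℂ) (x v : V) : ℂ :=
  (1 / 2) * (fderiv ℝ g x v + Complex.I * fderiv ℝ g x (Complex.I • v))

/-- The value on `(u, ū)` of the Hermitian form of the real `(1,1)`-form `√-1 ∂∂̄ φ`, i.e.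
`∑ (∂²φ/∂z^α∂z̄^β) u^α ū^β`. It is real when `φ` is real and `C²`. -/
def leviForm (φ : V → ℝ) (x u : V) : ℝ :=
  (dz (fun y => dzbar (fun t => (φ t : ℂ)) y u) x u).re

end Wirtinger

/-- The `α`-th coordinate vector of `ℂᵐ`. -/
def coordVec {m : ℕ} (α : Fin m) : CSpace m := EuclideanSpace.single α 1

/-! ### Tangent vectors of a complex manifold in holomorphic coordinates -/

section ChartVec

variable {m : ℕ} {M : Type*} [TopologicalSpace M] [ChartedSpace (CSpace m) M]

/-- The holomorphic tangent vector at `e.symm z` with coordinates `v` in the chart `e`,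
i.e. `∑ v^α ∂/∂z^α`. (The complex tangent space is canonically the holomorphic tangent space.) -/
def chartVec (e : OpenPartialHomeomorph M (CSpace m)) (z v : CSpace m) :
    TangentSpace 𝓘(ℂ, CSpace m) (e.symm z) :=
  mfderiv 𝓘(ℂ, CSpace m) 𝓘(ℂ, CSpace m) e.symm z v

end ChartVec

/-! ### The projective bundle `ℙ(T_M)`, its tautological line bundle and RC-positivity -/

section Projective

variable (m : ℕ) (M : Type*) [TopologicalSpace M] [ChartedSpace (CSpace m) M]

/-- The projective bundle `ℙ(T_M)`: pairs of a point `p` and a line in `T_p M`. Its standard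
holomorphic coordinates are `(z, w)`, where `z` are holomorphic coordinates of `M` and `w` are
the affine coordinates of the line `[W^1 : ⋯ : W^m]` on the set `W^j ≠ 0`. -/
abbrev ProjTangent : Type _ := Σ p : M, ℙ ℂ (TangentSpace 𝓘(ℂ, CSpace m) p)

variable {m}

/-- The vector of `ℂᵐ` whose `j`-th coordinate is `1` and whose other coordinates are `w`:
the representative of the line with affine coordinates `w` on `W^j ≠ 0`. -/
def affineVec (j : Fin m) (w : {i : Fin m // i ≠ j} → ℂ) : CSpace m :=
  WithLp.toLp 2 fun i => if h : i = j then 1 else w ⟨i, h⟩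

/-- A function `T_M → ℝ` obtained from norms on the lines of `ℙ(T_M)`: the squared length of
`v` as an element of the line `ℂ v`. (For `v = 0` it is `0`.) -/
def normSqOf {M : Type*} [TopologicalSpace M] [ChartedSpace (CSpace m) M]
    (H : (x : ProjTangent m M) → x.2.submodule → ℝ)
    (p : M) (v : TangentSpace 𝓘(ℂ, CSpace m) p) : ℝ :=
  open Classical in
  if hv : v = 0 then 0
  else H ⟨p, Projectivization.mk ℂ v hv⟩
    ⟨v, by rw [Projectivization.submodule_mk]; exact Submodule.mem_span_singleton_self v⟩

/-- The local weight `|s|²` of a family of norms on the lines of `ℙ(T_M)`, in the standard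
coordinates `(z, w)` of `ℙ(T_M)` given by the chart `e` of `M` and the affine chart `W^j ≠ 0`.
Here `s` is the standard holomorphic frame `∂/∂z^j + ∑_{i ≠ j} w^i ∂/∂z^i` of the tautological
line bundle. -/
def tautWeight {M : Type*} [TopologicalSpace M] [ChartedSpace (CSpace m) M]
    (H : (x : ProjTangent m M) → x.2.submodule → ℝ)
    (e : OpenPartialHomeomorph M (CSpace m)) (j : Fin m)
    (q : CSpace m × ({i : Fin m // i ≠ j} → ℂ)) : ℝ :=
  normSqOf H (e.symm q.1) (chartVec e q.1 (affineVec j q.2))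

/-- A smooth Hermitian metric on the tautological line bundle `𝒪_{T^*_M}(-1)` of `ℙ(T_M)`, whose
fibre over `(p, ℓ)` is the line `ℓ ⊆ T_p M`. A Hermitian metric on a complex line is the same as
its squared norm. -/
structure TautMetric where
  /-- the squared norm on each line -/
  normSq : (x : ProjTangent m M) → x.2.submodule → ℝ
  normSq_smul : ∀ (x : ProjTangent m M) (c : ℂ) (v : x.2.submodule),
    normSq x (c • v) = ‖c‖ ^ 2 * normSq x v
  normSq_pos : ∀ (x : ProjTangent m M) (v : x.2.submodule), v ≠ 0 → 0 < normSq x v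
  smooth : ∀ e ∈ atlas (CSpace m) M, ∀ j : Fin m,
    ContDiffOn ℝ ∞ (tautWeight normSq e j) (e.target ×ˢ Set.univ)

/-- The value on `(u, ū)` of the Chern curvature `-√-1 ∂∂̄ log |s|²` of a Hermitian metric on
`𝒪_{T^*_M}(-1)`, at the point of `ℙ(T_M)` with standard coordinates `q`, for the tangent vector
of `ℙ(T_M)` with coordinates `u`. -/
def TautMetric.curvature {M : Type*} [TopologicalSpace M] [ChartedSpace (CSpace m) M]
    (H : TautMetric (m := m) M) (e : OpenPartialHomeomorph M (CSpace m)) (j : Fin m)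
    (q u : CSpace m × ({i : Fin m // i ≠ j} → ℂ)) : ℝ :=
  -leviForm (fun t => Real.log (tautWeight H.normSq e j t)) q u

variable (m) in
/-- `𝒪_{T^*_M}(-1)` is RC-positive: it has a smooth Hermitian metric whose Chern curvature has at
least one positive eigenvalue (equivalently, is positive in some direction `u`) at every point of
`ℙ(T_M)`. -/
def TautRCPositive : Prop :=
  ∃ H : TautMetric (m := m) M, ∀ e ∈ atlas (CSpace m) M, ∀ j : Fin m,
    ∀ z ∈ e.target, ∀ w : {i : Fin m // i ≠ j} → ℂ,
      ∃ u : CSpace m × ({i : Fin m // i ≠ j} → ℂ), 0 < H.curvature e j (z, w) u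

end Projective

/-! ### Riemannian curvature in coordinates -/

section Riemannian

variable {V : Type*} [NormedAddCommGroup V] [NormedSpace ℝ V]
  {ι : Type*} [Fintype ι] [DecidableEq ι]

/-- Christoffel symbol `Γ^k_{ij}` of the Levi-Civita connection of the metric `g_{ij}`, where
`b` are the coordinate vectors, so that `∂_i` is the derivative in the direction `b i`. -/
def leviCivita (b : ι → V) (g : V → Matrix ι ι ℝ) (k i j : ι) (x : V) : ℝ :=
  (1 / 2) * ∑ l, (g x)⁻¹ k l *
    (fderiv ℝ (fun y => g y j l) x (b i) + fderiv ℝ (fun y => g y i l) x (b j)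
      - fderiv ℝ (fun y => g y i j) x (b l))

/-- `R_{ijk}^l`, where `R(X,Y)Z = ∇_X ∇_Y Z - ∇_Y ∇_X Z - ∇_{[X,Y]} Z`. -/
def riemann (b : ι → V) (g : V → Matrix ι ι ℝ) (i j k l : ι) (x : V) : ℝ :=
  fderiv ℝ (leviCivita b g l k j) x (b i) - fderiv ℝ (leviCivita b g l k i) x (b j)
    + ∑ p, (leviCivita b g p k j x * leviCivita b g l p i x
      - leviCivita b g p k i x * leviCivita b g l p j x)

/-- `R_{ijkl} = ∑ g_{sl} R_{ijk}^s`, so that `R(X,Y,Z,W) = g(R(X,Y)Z, W)`. -/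
def riemannLow (b : ι → V) (g : V → Matrix ι ι ℝ) (i j k l : ι) (x : V) : ℝ :=
  ∑ s, g x s l * riemann b g i j k s x

/-- `g(X, Y)` at `x`, for vectors given by their coordinates. -/
def metricPairing (g : V → Matrix ι ι ℝ) (x : V) (X Y : ι → ℝ) : ℝ :=
  ∑ i, ∑ j, g x i j * X i * Y j

/-- The sectional curvature `R(X,Y,Y,X) / (|X|²|Y|² - g(X,Y)²)` of the plane spanned by the
linearly independent vectors `X`, `Y`. -/
def sectionalCurvature (b : ι → V) (g : V → Matrix ι ι ℝ) (x : V) (X Y : ι → ℝ) : ℝ :=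
  (∑ i, ∑ j, ∑ k, ∑ l, riemannLow b g i j k l x * X i * Y j * Y k * X l) /
    (metricPairing g x X X * metricPairing g x Y Y - metricPairing g x X Y ^ 2)

end Riemannian

/-! ### Hermitian and Kähler metrics -/

section Hermitian

variable (n : ℕ) (N : Type*) [TopologicalSpace N] [ChartedSpace (CSpace n) N]

/-- A smooth Hermitian metric on (the holomorphic tangent bundle of) a complex manifold, linear
in the first and conjugate linear in the second variable. -/
structure HermitianMetric where
  /-- the Hermitian inner product on each tangent space -/
  form : (p : N) → TangentSpace 𝓘(ℂ, CSpace n) p → TangentSpace 𝓘(ℂ, CSpace n) p → ℂ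
  add_left : ∀ p u v w, form p (u + v) w = form p u w + form p v w
  smul_left : ∀ p (c : ℂ) u v, form p (c • u) v = c * form p u v
  conj_symm : ∀ p u v, star (form p u v) = form p v u
  re_pos : ∀ p u, u ≠ 0 → 0 < (form p u u).re
  smooth : ∀ e ∈ atlas (CSpace n) N, ∀ k l : Fin n,
    ContDiffOn ℝ ∞ (fun z => form (e.symm z) (chartVec e z (coordVec k))
      (chartVec e z (coordVec l))) e.target

variable {n N}

/-- The matrix `g_{k l̄} = g(∂/∂w^k, ∂/∂w^l)` of a Hermitian metric in a holomorphic chart. -/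
def HermitianMetric.coeff (g : HermitianMetric n N) (e : OpenPartialHomeomorph N (CSpace n))
    (z : CSpace n) : Matrix (Fin n) (Fin n) ℂ :=
  fun k l => g.form (e.symm z) (chartVec e z (coordVec k)) (chartVec e z (coordVec l))

/-- The metric is Kähler: the form `√-1 ∑ g_{k l̄} dw^k ∧ dw̄^l` is closed, i.e.
`∂g_{k l̄}/∂w^j = ∂g_{j l̄}/∂w^k` in holomorphic coordinates. -/
def HermitianMetric.IsKahler (g : HermitianMetric n N) : Prop :=
  ∀ e ∈ atlas (CSpace n) N, ∀ z ∈ e.target, ∀ j k l : Fin n,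
    dz (fun y => g.coeff e y k l) z (coordVec j) = dz (fun y => g.coeff e y j l) z (coordVec k)

/-- The Christoffel symbol `Γ^i_{jk} = ∑_l g^{i l̄} ∂g_{k l̄}/∂w^j` of the Chern connection.
Here `(g^{i l̄})` is the transpose of the inverse of the matrix `(g_{k l̄})`, i.e.
`∑_l g^{i l̄} g_{k l̄} = δ^i_k`. -/
def HermitianMetric.chernSymbol (g : HermitianMetric n N)
    (e : OpenPartialHomeomorph N (CSpace n)) (i j k : Fin n) (z : CSpace n) : ℂ :=
  ∑ l, (g.coeff e z)⁻¹ l i * dz (fun y => g.coeff e y k l) z (coordVec j)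

/-- The real coordinate vectors `∂/∂x^k` and `∂/∂y^k` of `ℂⁿ`, where `w^k = x^k + √-1 y^k`. -/
def realCoordVec : Fin n ⊕ Fin n → CSpace n
  | Sum.inl k => coordVec k
  | Sum.inr k => Complex.I • coordVec k

/-- The matrix, in the real coordinates `(x^k, y^k)`, of the underlying Riemannian metric, which
is the real part of the Hermitian metric. -/
def HermitianMetric.realCoeff (g : HermitianMetric n N)
    (e : OpenPartialHomeomorph N (CSpace n)) (z : CSpace n) :
    Matrix (Fin n ⊕ Fin n) (Fin n ⊕ Fin n) ℝ :=
  fun a b => (g.form (e.symm z) (chartVec e z (realCoordVec a))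
    (chartVec e z (realCoordVec b))).re

/-- The underlying Riemannian metric has non-positive sectional curvature. -/
def HermitianMetric.NonposSectionalCurvature (g : HermitianMetric n N) : Prop :=
  ∀ e ∈ atlas (CSpace n) N, ∀ z ∈ e.target, ∀ X Y : Fin n ⊕ Fin n → ℝ,
    LinearIndependent ℝ ![X, Y] →
      sectionalCurvature realCoordVec (g.realCoeff e) z X Y ≤ 0

end Hermitian

/-! ### Pluri-harmonic maps -/

section Pluriharmonic

variable {m n : ℕ} {M N : Type*} [TopologicalSpace M] [ChartedSpace (CSpace m) M]
  [TopologicalSpace N] [ChartedSpace (CSpace n) N]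

/-- The `i`-th component `f^i` of a map in charts of the source and the target. -/
def localComp (f : M → N) (φ : OpenPartialHomeomorph M (CSpace m))
    (ψ : OpenPartialHomeomorph N (CSpace n)) (i : Fin n) (z : CSpace m) : ℂ :=
  ψ (f (φ.symm z)) i

/-- A smooth map `f` from a complex manifold to a Hermitian manifold is pluri-harmonic with
respect to the Chern connection: `∂_E ∂̄ f = 0` for `E = f^*(T^{1,0}N)`, i.e.
`∂²f^i/∂z^α∂z̄^β + ∑ Γ^i_{jk} (∂f^j/∂z^α) (∂f^k/∂z̄^β) = 0` in holomorphic coordinates. -/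
structure IsPluriharmonic (g : HermitianMetric n N) (f : M → N) : Prop where
  smooth : ContMDiff 𝓘(ℝ, CSpace m) 𝓘(ℝ, CSpace n) ∞ f
  eq_zero : ∀ φ ∈ atlas (CSpace m) M, ∀ ψ ∈ atlas (CSpace n) N,
    ∀ z ∈ φ.target, f (φ.symm z) ∈ ψ.source → ∀ (α β : Fin m) (i : Fin n),
      dz (fun y => dzbar (localComp f φ ψ i) y (coordVec β)) z (coordVec α)
        + ∑ j, ∑ k, g.chernSymbol ψ i j k (ψ (f (φ.symm z)))
            * dz (localComp f φ ψ j) z (coordVec α)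
            * dzbar (localComp f φ ψ k) z (coordVec β) = 0

end Pluriharmonic

end KahlerRigidity

end

/-! Put `energy(v) = |df(v)|² + |df(Jv)|²`, with `J` multiplication by `√-1` on the source. Up to a
constant this is the squared length of `σ = df(v) - √-1 df(Jv)` in the complexified bundle `f^*TN ⊗
ℂ`. Divided by the RC-positive metric `|v|²`, it is homogeneous of degree zero in `v`, hence a
continuous function on the compact space `ℙ(T_M)`, and it attains its maximum.

Suppose the maximum is positive. There `log energy(s) - log |s|²`, with `s` the standard holomorphic
frame of the tautological bundle, has a local maximum, so its Levi form is non-positive in every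
direction. But `-log |s|²` has positive Levi form in some direction, by RC-positivity, while `log
energy(s)` is plurisubharmonic wherever the energy is positive: a contradiction. So the energy
vanishes identically, `df = 0`, and `f` is constant since `M` is connected. Using the full
complexified tangent bundle of `N`, not only `T^{1,0}N`, is what gives `df = 0` rather than just the
vanishing of `∂f`.

Plurisubharmonicity is a Bochner argument. The Chern connection of a Kähler metric is the
Levi-Civita connection (`HermitianMetric.isLeviCivitaOn`), so pluri-harmonicity says that the
`(1,1)`-part of the real Hessian of `f` vanishes (`isRealPluriharmonicOn`). Equivalently, `σ`
satisfies the Cauchy-Riemann equations for the pulled-back connection. For such a section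
Cauchy-Schwarz bounds the Levi form of `log |σ|²` below by a curvature term
(`dirDeriv2_log_pairing_nonneg`). Differentiating the pluri-harmonic equation once more makes the
`(0,2)`-curvature annihilate `σ`; with the Bianchi identity this turns the curvature term into a sum
of four terms `⟨R(A,B)A,B⟩`, non-negative when the sectional curvature is non-positive
(`curvature_nonneg`). -/

noncomputable section

namespace KahlerRigidity

/-! ### Calculus of smooth functions and symmetry of second derivatives -/

section Smooth

variable {V E : Type*} [NormedAddCommGroup V] [NormedSpace ℝ V]
  [NormedAddCommGroup E] [NormedSpace ℝ E]

theorem contDiffAt_fderiv {a : V → E} {x : V} (ha : ContDiffAt ℝ ∞ a x) :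
    ContDiffAt ℝ ∞ (fderiv ℝ a) x :=
  ha.fderiv_right (by norm_cast)

theorem contDiffAt_fderiv_apply {a : V → E} {x : V} (ha : ContDiffAt ℝ ∞ a x) (u : V) :
    ContDiffAt ℝ ∞ (fun y => fderiv ℝ a y u) x :=
  (contDiffAt_fderiv ha).clm_apply contDiffAt_const

theorem differentiableAt_of_smooth {a : V → E} {x : V} (ha : ContDiffAt ℝ ∞ a x) :
    DifferentiableAt ℝ a x :=
  ha.differentiableAt (by simp)

theorem eventually_contDiffAt {a : V → E} {x : V} (ha : ContDiffAt ℝ ∞ a x) :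
    ∀ᶠ y in nhds x, ContDiffAt ℝ 1 a y :=
  (ha.of_le (by norm_cast : (1 : WithTop ℕ∞) ≤ ∞)).eventually (by simp)

theorem fderiv_fderiv_symm {a : V → E} {x : V} (ha : ContDiffAt ℝ ∞ a x) (u v : V) :
    fderiv ℝ (fderiv ℝ a) x u v = fderiv ℝ (fderiv ℝ a) x v u :=
  (ha.isSymmSndFDerivAt (by
    rw [minSmoothness_of_isRCLikeNormedField]; norm_cast)).eq u v

theorem fderiv_fderiv_apply {a : V → E} {x : V} (ha : ContDiffAt ℝ ∞ a x) (u v : V) :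
    fderiv ℝ (fun y => fderiv ℝ a y v) x u = fderiv ℝ (fderiv ℝ a) x u v := by
  have h := (differentiableAt_of_smooth (contDiffAt_fderiv ha)).hasFDerivAt.clm_apply
    (hasFDerivAt_const v x)
  rw [h.fderiv]; simp

theorem fderiv_apply_comm {a : V → E} {x : V} (ha : ContDiffAt ℝ ∞ a x) (u v : V) :
    fderiv ℝ (fun y => fderiv ℝ a y v) x u = fderiv ℝ (fun y => fderiv ℝ a y u) x v := by
  rw [fderiv_fderiv_apply ha, fderiv_fderiv_apply ha, fderiv_fderiv_symm ha]

end Smooth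

/-! ### Covariant derivatives along a map, in coordinates -/

section Connection

variable {V E : Type*} [NormedAddCommGroup V] [NormedSpace ℝ V]
  [NormedAddCommGroup E] [NormedSpace ℝ E]

/-- The covariant derivative in the direction `u` of a vector field `a` along `F`, for the
connection with Christoffel symbols `Γ`. -/
def covDeriv (Γ : E → E →L[ℝ] E →L[ℝ] E) (F : V → E) (u : V) (a : V → E) (x : V) : E :=
  fderiv ℝ a x u + Γ (F x) (fderiv ℝ F x u) (a x)

/-- The curvature `R(X,Y)Z` of the connection with Christoffel symbols `Γ`. -/
def curvOp (Γ : E → E →L[ℝ] E →L[ℝ] E) (y X Y Z : E) : E :=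
  fderiv ℝ Γ y X Y Z - fderiv ℝ Γ y Y X Z + Γ y X (Γ y Y Z) - Γ y Y (Γ y X Z)

variable {Γ : E → E →L[ℝ] E →L[ℝ] E} {F : V → E} {x : V}

theorem covDeriv_smooth (hΓ : ContDiffAt ℝ ∞ Γ (F x)) (hF : ContDiffAt ℝ ∞ F x)
    {a : V → E} (ha : ContDiffAt ℝ ∞ a x) (u : V) :
    ContDiffAt ℝ ∞ (covDeriv Γ F u a) x :=
  (contDiffAt_fderiv_apply ha u).add
    (((hΓ.comp x hF).clm_apply (contDiffAt_fderiv_apply hF u)).clm_apply ha)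

theorem covDeriv_congr {a b : V → E} (h : a =ᶠ[nhds x] b) (u : V) :
    covDeriv Γ F u a x = covDeriv Γ F u b x := by
  simp only [covDeriv, h.fderiv_eq, h.eq_of_nhds]

theorem covDeriv_neg (a : V → E) (u : V) :
    covDeriv Γ F u (fun y => -a y) x = -covDeriv Γ F u a x := by
  simp only [covDeriv, fderiv_fun_neg, map_neg, neg_add]
  simp

theorem covDeriv_add {a b : V → E} (ha : DifferentiableAt ℝ a x) (hb : DifferentiableAt ℝ b x)
    (u : V) : covDeriv Γ F u (fun y => a y + b y) x
      = covDeriv Γ F u a x + covDeriv Γ F u b x := by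
  simp only [covDeriv, fderiv_fun_add ha hb, map_add, add_apply]
  abel

theorem covDeriv_zero (u : V) : covDeriv Γ F u (fun _ => 0) x = 0 := by
  simp [covDeriv]

/-- Constant directions `u`, `v` commute, so there is no bracket term: the Hessians of `a` and of
`F` cancel by symmetry, leaving the pulled-back curvature. Torsion-freeness is not needed. -/
theorem covDeriv_comm (hΓ : ContDiffAt ℝ ∞ Γ (F x)) (hF : ContDiffAt ℝ ∞ F x)
    {a : V → E} (ha : ContDiffAt ℝ ∞ a x) (u v : V) :
    covDeriv Γ F u (covDeriv Γ F v a) x - covDeriv Γ F v (covDeriv Γ F u a) x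
      = curvOp Γ (F x) (fderiv ℝ F x u) (fderiv ℝ F x v) (a x) := by
  have key : ∀ u v : V, fderiv ℝ (covDeriv Γ F v a) x u
      = fderiv ℝ (fderiv ℝ a) x u v
        + (fderiv ℝ Γ (F x) (fderiv ℝ F x u) (fderiv ℝ F x v) (a x)
          + Γ (F x) (fderiv ℝ (fderiv ℝ F) x u v) (a x)
          + Γ (F x) (fderiv ℝ F x v) (fderiv ℝ a x u)) := by
    intro u v
    have hc : HasFDerivAt (fun _ : V => v) (0 : V →L[ℝ] V) x := hasFDerivAt_const v x
    have h1 := (differentiableAt_of_smooth (contDiffAt_fderiv ha)).hasFDerivAt.clm_apply hc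
    have h2 := (differentiableAt_of_smooth (contDiffAt_fderiv hF)).hasFDerivAt.clm_apply hc
    have h3 := (differentiableAt_of_smooth hΓ).hasFDerivAt.comp x
      (differentiableAt_of_smooth hF).hasFDerivAt
    have h4 := h1.add ((h3.clm_apply h2).clm_apply
      (differentiableAt_of_smooth ha).hasFDerivAt)
    have h5 : fderiv ℝ (covDeriv Γ F v a) x = _ := h4.fderiv
    rw [h5]
    simp
    abel
  simp only [covDeriv] at key ⊢
  rw [key, key, fderiv_fderiv_symm ha u v, fderiv_fderiv_symm hF u v]
  simp only [curvOp, map_add]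
  abel

theorem curvOp_antisymm (y X Y Z : E) : curvOp Γ y X Y Z = -curvOp Γ y Y X Z := by
  simp only [curvOp]; abel

end Connection

/-! ### Levi-Civita connections and the symmetries of the curvature tensor -/

section Metric

variable {V E : Type*} [NormedAddCommGroup V] [NormedSpace ℝ V]
  [NormedAddCommGroup E] [NormedSpace ℝ E]

/-- On the open set `O` the connection `Γ` is the Levi-Civita connection of the Riemannian
metric `G`. -/
structure IsLeviCivitaOn (G : E → E →L[ℝ] E →L[ℝ] ℝ) (Γ : E → E →L[ℝ] E →L[ℝ] E)
    (O : Set E) : Prop where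
  isOpen : IsOpen O
  smooth_metric : ∀ y ∈ O, ContDiffAt ℝ ∞ G y
  smooth_symbol : ∀ y ∈ O, ContDiffAt ℝ ∞ Γ y
  metric_symm : ∀ y ∈ O, ∀ a b, G y a b = G y b a
  metric_nonneg : ∀ y ∈ O, ∀ a, 0 ≤ G y a a
  symbol_symm : ∀ y ∈ O, ∀ a b, Γ y a b = Γ y b a
  compat : ∀ y ∈ O, ∀ v a b, fderiv ℝ G y v a b = G y (Γ y v a) b + G y a (Γ y v b)

variable {G : E → E →L[ℝ] E →L[ℝ] ℝ} {Γ : E → E →L[ℝ] E →L[ℝ] E} {O : Set E}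

namespace IsLeviCivitaOn

theorem fderiv_pairing (h : IsLeviCivitaOn G Γ O) {F : V → E} {x : V} (hx : F x ∈ O)
    (hF : DifferentiableAt ℝ F x) {a b : V → E} (ha : DifferentiableAt ℝ a x)
    (hb : DifferentiableAt ℝ b x) (u : V) :
    fderiv ℝ (fun y => G (F y) (a y) (b y)) x u
      = G (F x) (covDeriv Γ F u a x) (b x) + G (F x) (a x) (covDeriv Γ F u b x) := by
  have h3 := (differentiableAt_of_smooth (h.smooth_metric _ hx)).hasFDerivAt.comp x
    hF.hasFDerivAt
  have h4 := (h3.clm_apply ha.hasFDerivAt).clm_apply hb.hasFDerivAt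
  have h5 : fderiv ℝ (fun y => G (F y) (a y) (b y)) x = _ := h4.fderiv
  rw [h5]
  simp [covDeriv, h.compat _ hx]
  abel

theorem pairing_smooth (h : IsLeviCivitaOn G Γ O) {F : V → E} {x : V} (hx : F x ∈ O)
    (hF : ContDiffAt ℝ ∞ F x) {a b : V → E} (ha : ContDiffAt ℝ ∞ a x)
    (hb : ContDiffAt ℝ ∞ b x) : ContDiffAt ℝ ∞ (fun y => G (F y) (a y) (b y)) x :=
  (((h.smooth_metric _ hx).comp x hF).clm_apply ha).clm_apply hb

theorem eventually_mem (h : IsLeviCivitaOn G Γ O) {F : V → E} {x : V} (hx : F x ∈ O)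
    (hF : ContDiffAt ℝ ∞ F x) : ∀ᶠ y in nhds x, F y ∈ O :=
  hF.continuousAt.eventually (h.isOpen.mem_nhds hx)

/-- Second derivatives of `⟨a, b⟩` for vector fields along a map. -/
theorem fderiv_fderiv_pairing (h : IsLeviCivitaOn G Γ O) {F : V → E} {x : V} (hx : F x ∈ O)
    (hF : ContDiffAt ℝ ∞ F x) {a b : V → E} (ha : ContDiffAt ℝ ∞ a x)
    (hb : ContDiffAt ℝ ∞ b x) (u v : V) :
    fderiv ℝ (fun y => fderiv ℝ (fun t => G (F t) (a t) (b t)) y v) x u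
      = G (F x) (covDeriv Γ F u (covDeriv Γ F v a) x) (b x)
        + G (F x) (covDeriv Γ F v a x) (covDeriv Γ F u b x)
        + (G (F x) (covDeriv Γ F u a x) (covDeriv Γ F v b x)
        + G (F x) (a x) (covDeriv Γ F u (covDeriv Γ F v b) x)) := by
  have hΓ := h.smooth_symbol _ hx
  have hav := covDeriv_smooth hΓ hF ha v
  have hbv := covDeriv_smooth hΓ hF hb v
  have he : (fun y => fderiv ℝ (fun t => G (F t) (a t) (b t)) y v) =ᶠ[nhds x] fun y =>
      G (F y) (covDeriv Γ F v a y) (b y) + G (F y) (a y) (covDeriv Γ F v b y) := by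
    filter_upwards [h.eventually_mem hx hF, eventually_contDiffAt hF, eventually_contDiffAt ha,
      eventually_contDiffAt hb] with y h1 h2 h3 h4
    exact h.fderiv_pairing h1 (h2.differentiableAt (by simp)) (h3.differentiableAt (by simp))
      (h4.differentiableAt (by simp)) v
  rw [he.fderiv_eq, fderiv_fun_add (differentiableAt_of_smooth (h.pairing_smooth hx hF hav hb))
    (differentiableAt_of_smooth (h.pairing_smooth hx hF ha hbv)),
    add_apply,
    h.fderiv_pairing hx (differentiableAt_of_smooth hF) (differentiableAt_of_smooth hav)
      (differentiableAt_of_smooth hb),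
    h.fderiv_pairing hx (differentiableAt_of_smooth hF) (differentiableAt_of_smooth ha)
      (differentiableAt_of_smooth hbv)]

/-- Second derivatives of the function `⟨Z, W⟩`, for constant fields along the identity map,
commute; the difference of the two orders is `⟨R Z, W⟩ + ⟨Z, R W⟩`. -/
theorem curv_skew_pairing (h : IsLeviCivitaOn G Γ O) {y : E} (hy : y ∈ O) (X Y Z W : E) :
    G y (curvOp Γ y X Y Z) W = -G y (curvOp Γ y X Y W) Z := by
  have hid : ContDiffAt ℝ ∞ (fun t : E => t) y := contDiffAt_id
  have hZ : ContDiffAt ℝ ∞ (fun _ : E => Z) y := contDiffAt_const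
  have hW : ContDiffAt ℝ ∞ (fun _ : E => W) y := contDiffAt_const
  have hc := fderiv_apply_comm (h.pairing_smooth (F := fun t => t) hy hid hZ hW) X Y
  rw [h.fderiv_fderiv_pairing (F := fun t => t) hy hid hZ hW,
    h.fderiv_fderiv_pairing (F := fun t => t) hy hid hZ hW] at hc
  have hΓ := h.smooth_symbol _ hy
  have e1 := covDeriv_comm (F := fun t => t) hΓ hid hZ X Y
  have e2 := covDeriv_comm (F := fun t => t) hΓ hid hW X Y
  simp only [fderiv_fun_id, ContinuousLinearMap.id_apply] at e1 e2
  rw [h.metric_symm _ hy (curvOp Γ y X Y W), ← e1, ← e2]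
  simp only [map_sub, sub_apply]
  linarith

/-- Symmetry of `Γ` passes to its derivative, because it holds on an open set; everything then
cancels in pairs. -/
theorem bianchi (h : IsLeviCivitaOn G Γ O) {y : E} (hy : y ∈ O) (X Y Z : E) :
    curvOp Γ y X Y Z + curvOp Γ y Y Z X + curvOp Γ y Z X Y = 0 := by
  have hd : ∀ v a b, fderiv ℝ Γ y v a b = fderiv ℝ Γ y v b a := by
    intro v a b
    have e : (fun t => Γ t a b) =ᶠ[nhds y] fun t => Γ t b a := by
      filter_upwards [h.isOpen.mem_nhds hy] with t ht using h.symbol_symm t ht a b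
    have hs := (differentiableAt_of_smooth (h.smooth_symbol _ hy)).hasFDerivAt
    have k : ∀ a b, fderiv ℝ (fun t => Γ t a b) y v = fderiv ℝ Γ y v a b := by
      intro a b
      have := ((hs.clm_apply (hasFDerivAt_const a y)).clm_apply (hasFDerivAt_const b y)).fderiv
      rw [this]; simp
    rw [← k, ← k, e.fderiv_eq]
  simp only [curvOp]
  rw [hd X Z Y, hd Y X Z, hd Z Y X, h.symbol_symm y hy Z Y, h.symbol_symm y hy X Z,
    h.symbol_symm y hy Y X]
  abel

/-- The classical octahedron argument: a combination of four Bianchi identities with the two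
antisymmetries. -/
theorem curv_pair_symm (h : IsLeviCivitaOn G Γ O) {y : E} (hy : y ∈ O) (X Y Z W : E) :
    G y (curvOp Γ y X Y Z) W = G y (curvOp Γ y Z W X) Y := by
  have B : ∀ X Y Z W, G y (curvOp Γ y X Y Z) W + G y (curvOp Γ y Y Z X) W
      + G y (curvOp Γ y Z X Y) W = 0 := by
    intro X Y Z W
    have := congrArg (fun t => G y t W) (h.bianchi hy X Y Z)
    simpa using this
  have A : ∀ X Y Z W, G y (curvOp Γ y X Y Z) W = -G y (curvOp Γ y Y X Z) W := by
    intro X Y Z W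
    rw [curvOp_antisymm y X Y Z]; simp
  have S := fun X Y Z W => h.curv_skew_pairing hy X Y Z W
  linarith [B X Y Z W, B Y Z W X, B Z W X Y, B W X Y Z, A X Y Z W, S X Y Z W, A Y Z X W,
    S Y Z X W, A Z X Y W, S Z X Y W, A Y Z W X, S Y Z W X, A Z W Y X, S Z W Y X, A W Y Z X,
    S W Y Z X, A Z W X Y, S Z W X Y, A W X Z Y, S W X Z Y, A X Z W Y, S X Z W Y, A W X Y Z,
    S W X Y Z, A X Y W Z, S X Y W Z, A Y W X Z, S Y W X Z]

end IsLeviCivitaOn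

end Metric

/-! ### Pluri-harmonic maps: integrability and the sign of the curvature term -/

section Bochner

variable {V E : Type*} [NormedAddCommGroup V] [NormedSpace ℂ V]
  [NormedAddCommGroup E] [NormedSpace ℝ E]
  {G : E → E →L[ℝ] E →L[ℝ] ℝ} {Γ : E → E →L[ℝ] E →L[ℝ] E} {O : Set E}
  {F : V → E} {U : Set V}

/-- The map `F` is smooth on the open set `U` with values in `O`, and its second fundamental form
`(u, v) ↦ ∇_u (dF v)` has vanishing `(1,1)`-part. -/
structure IsRealPluriharmonicOn (Γ : E → E →L[ℝ] E →L[ℝ] E) (O : Set E) (F : V → E)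
    (U : Set V) : Prop where
  isOpen : IsOpen U
  smooth : ∀ x ∈ U, ContDiffAt ℝ ∞ F x
  mapsTo : ∀ x ∈ U, F x ∈ O
  eq_zero : ∀ x ∈ U, ∀ u v : V, covDeriv Γ F u (fun y => fderiv ℝ F y v) x
    + covDeriv Γ F (Complex.I • u) (fun y => fderiv ℝ F y (Complex.I • v)) x = 0

namespace IsRealPluriharmonicOn

theorem I_smul_I_smul (v : V) : Complex.I • Complex.I • v = -v := by
  rw [smul_smul, Complex.I_mul_I]; simp

theorem covDeriv_I_smul (hF : IsRealPluriharmonicOn Γ O F U) {x : V} (hx : x ∈ U) (u v : V) :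
    covDeriv Γ F (Complex.I • u) (fun y => fderiv ℝ F y v) x
      = covDeriv Γ F u (fun y => fderiv ℝ F y (Complex.I • v)) x := by
  have h := hF.eq_zero x hx u (Complex.I • v)
  rw [I_smul_I_smul] at h
  have : covDeriv Γ F (Complex.I • u) (fun y => fderiv ℝ F y (-v)) x
    = -covDeriv Γ F (Complex.I • u) (fun y => fderiv ℝ F y v) x := by
    rw [← covDeriv_neg]; simp only [map_neg]
  rw [this] at h
  exact (sub_eq_zero.1 (by rw [sub_eq_add_neg]; exact h)).symm

/-- In complex terms, with `∂F(w) = dF(w) - √-1 dF(Jw)`: the pluri-harmonic equation says `∇_{ū}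
∂F(w) = 0` for all `u`, `w`, so commuting two such derivatives gives `R(dF(ū), dF(v̄)) ∂F(w) = 0`.
The formula is the real part of this. -/
theorem integrability (hF : IsRealPluriharmonicOn Γ O F U) (hL : IsLeviCivitaOn G Γ O) {x : V}
    (hx : x ∈ U) (u v w : V) :
    curvOp Γ (F x) (fderiv ℝ F x u) (fderiv ℝ F x v) (fderiv ℝ F x w)
      - curvOp Γ (F x) (fderiv ℝ F x (Complex.I • u)) (fderiv ℝ F x (Complex.I • v))
        (fderiv ℝ F x w)
      + (curvOp Γ (F x) (fderiv ℝ F x u) (fderiv ℝ F x (Complex.I • v))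
          (fderiv ℝ F x (Complex.I • w))
        + curvOp Γ (F x) (fderiv ℝ F x (Complex.I • u)) (fderiv ℝ F x v)
          (fderiv ℝ F x (Complex.I • w))) = 0 := by
  have hs := hF.smooth x hx
  have hΓ := hL.smooth_symbol _ (hF.mapsTo x hx)
  have hc := fun w => contDiffAt_fderiv_apply hs w
  have hcc := fun v w => differentiableAt_of_smooth (covDeriv_smooth hΓ hs (hc w) v)
  have hev : ∀ᶠ y in nhds x, y ∈ U := hF.isOpen.mem_nhds hx
  have T1 : ∀ u v w : V, covDeriv Γ F u (covDeriv Γ F v (fun y => fderiv ℝ F y w)) x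
      + covDeriv Γ F u (covDeriv Γ F (Complex.I • v)
          (fun y => fderiv ℝ F y (Complex.I • w))) x = 0 := by
    intro u v w
    rw [← covDeriv_add (hcc _ _) (hcc _ _), ← covDeriv_zero (Γ := Γ) (F := F) (x := x) u]
    apply covDeriv_congr
    filter_upwards [hev] with y hy using hF.eq_zero y hy v w
  have T2 : ∀ u v w : V, covDeriv Γ F u (covDeriv Γ F (Complex.I • v)
      (fun y => fderiv ℝ F y w)) x
      = covDeriv Γ F u (covDeriv Γ F v (fun y => fderiv ℝ F y (Complex.I • w))) x := by
    intro u v w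
    apply covDeriv_congr
    filter_upwards [hev] with y hy using hF.covDeriv_I_smul hy v w
  -- Written as commutators, the four curvatures give eight terms. `T2` makes four of them cancel;
  -- the others form the difference of two instances of `T1`.
  rw [← covDeriv_comm hΓ hs (hc w), ← covDeriv_comm hΓ hs (hc w), ← covDeriv_comm hΓ hs (hc _),
    ← covDeriv_comm hΓ hs (hc _)]
  rw [T2 (Complex.I • u) v w, T2 (Complex.I • v) u w]
  have e1 := T1 u v w
  have e2 := T1 v u w
  rw [← sub_zero (0 : E), ← congrArg₂ (· - ·) e1 e2]
  abel

/-- Integrability and non-positive sectional curvature control the curvature term of the Bochner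
formula. -/
theorem curvature_nonneg (hF : IsRealPluriharmonicOn Γ O F U) (hL : IsLeviCivitaOn G Γ O)
    (hneg : ∀ y ∈ O, ∀ X Y, 0 ≤ G y (curvOp Γ y X Y X) Y) {x : V} (hx : x ∈ U) (u v : V) :
    0 ≤ G (F x) (curvOp Γ (F x) (fderiv ℝ F x u) (fderiv ℝ F x (Complex.I • u))
      (fderiv ℝ F x v)) (fderiv ℝ F x (Complex.I • v)) := by
  have hy := hF.mapsTo x hx
  have e1 := hF.integrability hL hx u v u
  have e2 := hF.integrability hL hx u v (Complex.I • u)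
  rw [I_smul_I_smul, map_neg] at e2
  have n1 := hneg _ hy (fderiv ℝ F x u) (fderiv ℝ F x v)
  have n2 := hneg _ hy (fderiv ℝ F x u) (fderiv ℝ F x (Complex.I • v))
  have n3 := hneg _ hy (fderiv ℝ F x (Complex.I • u)) (fderiv ℝ F x v)
  have n4 := hneg _ hy (fderiv ℝ F x (Complex.I • u)) (fderiv ℝ F x (Complex.I • v))
  generalize fderiv ℝ F x u = X at *
  generalize fderiv ℝ F x (Complex.I • u) = Y at *
  generalize fderiv ℝ F x v = a at *
  generalize fderiv ℝ F x (Complex.I • v) = b at *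
  have hneg' : ∀ A B Z, curvOp Γ (F x) A B (-Z) = -curvOp Γ (F x) A B Z := by
    intro A B Z; simp only [curvOp, map_neg]; abel
  rw [hneg', hneg'] at e2
  -- Subtracting `f2` from `f1` leaves the four terms of `n1` to `n4` on one side. By pair symmetry
  -- and Bianchi the other side is `2⟨R(X,Y)a, b⟩`, twice the quantity to be bounded.
  have f1 := congrArg (fun t => G (F x) t a) e1
  have f2 := congrArg (fun t => G (F x) t b) e2
  simp only [map_add, map_sub, map_neg, map_zero, add_apply, sub_apply, neg_apply,
    zero_apply] at f1 f2
  have b0 := congrArg (fun t => G (F x) t b) (hL.bianchi hy X Y a)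
  simp only [map_add, add_apply, map_zero, zero_apply] at b0
  have p1 := hL.curv_pair_symm hy X a Y b
  have p2 := hL.curv_pair_symm hy X b Y a
  have s1 := congrArg (fun t => G (F x) t b) (curvOp_antisymm (Γ := Γ) (F x) a X Y)
  simp only [map_neg, neg_apply] at s1
  linarith [hL.curv_skew_pairing hy Y a X b, hL.curv_skew_pairing hy X b Y a]

end IsRealPluriharmonicOn

end Bochner

/-! ### Levi forms, logarithms and the second derivative test -/

section Levi

variable {V : Type*} [NormedAddCommGroup V] [NormedSpace ℂ V]

/-- The second derivative of `φ` at `x` in the direction `u`. -/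
def dirDeriv2 (φ : V → ℝ) (x u : V) : ℝ := fderiv ℝ (fun y => fderiv ℝ φ y u) x u

/-- The cross terms of `∂_u ∂̄_u` are purely imaginary for real `φ`, so the real part is a quarter
of the Laplacian along the complex line of `u`. -/
theorem leviForm_eq {φ : V → ℝ} {x : V} (hφ : ContDiffAt ℝ ∞ φ x) (u : V) :
    leviForm φ x u = (1 / 4) * (dirDeriv2 φ x u + dirDeriv2 φ x (Complex.I • u)) := by
  have hev : (fun y => dzbar (fun t => (φ t : ℂ)) y u) =ᶠ[nhds x] fun y =>
      (1 / 2) * ((fderiv ℝ φ y u : ℂ) + Complex.I * (fderiv ℝ φ y (Complex.I • u) : ℂ)) := by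
    filter_upwards [eventually_contDiffAt hφ] with y hy
    have := (Complex.ofRealCLM.hasFDerivAt.comp y
      (hy.differentiableAt (by simp)).hasFDerivAt)
    have h2 : fderiv ℝ (fun t => (φ t : ℂ)) y = _ := this.fderiv
    simp [dzbar, h2]
  have hd : ∀ v, HasFDerivAt (fun y => (fderiv ℝ φ y v : ℂ))
      (Complex.ofRealCLM.comp (fderiv ℝ (fun y => fderiv ℝ φ y v) x)) x := fun v =>
    Complex.ofRealCLM.hasFDerivAt.comp x
      (differentiableAt_of_smooth (contDiffAt_fderiv_apply hφ v)).hasFDerivAt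
  have h3 : fderiv ℝ (fun y => dzbar (fun t => (φ t : ℂ)) y u) x = _ := hev.fderiv_eq.trans
    (((hd u).add ((hd (Complex.I • u)).const_mul Complex.I)).const_mul (1 / 2)).fderiv
  simp only [leviForm, dz, h3, dirDeriv2]
  simp
  ring

theorem dirDeriv2_sub {φ ψ : V → ℝ} {x : V} (hφ : ContDiffAt ℝ ∞ φ x)
    (hψ : ContDiffAt ℝ ∞ ψ x) (u : V) :
    dirDeriv2 (fun y => φ y - ψ y) x u = dirDeriv2 φ x u - dirDeriv2 ψ x u := by
  have : (fun y => fderiv ℝ (fun t => φ t - ψ t) y u) =ᶠ[nhds x]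
      fun y => fderiv ℝ φ y u - fderiv ℝ ψ y u := by
    filter_upwards [eventually_contDiffAt hφ, eventually_contDiffAt hψ] with y h1 h2
    rw [fderiv_fun_sub (h1.differentiableAt (by simp)) (h2.differentiableAt (by simp)),
      sub_apply]
  rw [dirDeriv2, this.fderiv_eq, fderiv_fun_sub
    (differentiableAt_of_smooth (contDiffAt_fderiv_apply hφ u))
    (differentiableAt_of_smooth (contDiffAt_fderiv_apply hψ u)), sub_apply]
  rfl

theorem dirDeriv2_log {φ : V → ℝ} {x : V} (hφ : ContDiffAt ℝ ∞ φ x) (hpos : 0 < φ x) (u : V) :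
    dirDeriv2 (fun y => Real.log (φ y)) x u
      = dirDeriv2 φ x u / φ x - (fderiv ℝ φ x u) ^ 2 / (φ x) ^ 2 := by
  have hev : (fun y => fderiv ℝ (fun t => Real.log (φ t)) y u) =ᶠ[nhds x]
      fun y => fderiv ℝ φ y u / φ y := by
    filter_upwards [eventually_contDiffAt hφ,
      hφ.continuousAt.eventually (lt_mem_nhds hpos)] with y h1 h2
    rw [fderiv.log (h1.differentiableAt (by simp)) (ne_of_gt h2)]
    simp [div_eq_inv_mul]
  have h1 := (differentiableAt_of_smooth (contDiffAt_fderiv_apply hφ u)).hasFDerivAt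
  have h2 := (differentiableAt_of_smooth hφ).hasFDerivAt
  have h3 : HasFDerivAt (fun y => fderiv ℝ φ y u * (φ y)⁻¹) _ x :=
    h1.mul ((hasDerivAt_inv hpos.ne').comp_hasFDerivAt x h2)
  simp only [div_eq_mul_inv] at hev
  rw [dirDeriv2, hev.fderiv_eq, h3.fderiv]
  simp [dirDeriv2]
  field_simp
  ring

/-- At a local maximum second directional derivatives are non-positive. -/
theorem dirDeriv2_nonpos_of_isLocalMax {φ : V → ℝ} {x : V} (hφ : ContDiffAt ℝ ∞ φ x)
    (hmax : IsLocalMax φ x) (u : V) : dirDeriv2 φ x u ≤ 0 := by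
  by_contra! hpos
  let γ : ℝ → V := fun t => x + t • u
  have hγ : ∀ t, HasDerivAt γ u t := fun t => by
    have := ((hasDerivAt_id t).smul_const u).const_add x
    rw [one_smul] at this
    exact this
  have hγ0 : γ 0 = x := by simp [γ]
  have hcont : Continuous γ := by fun_prop
  have htend : Filter.Tendsto γ (nhds 0) (nhds x) := hγ0 ▸ hcont.tendsto 0
  have hd : deriv (φ ∘ γ) =ᶠ[nhds 0] fun t => fderiv ℝ φ (γ t) u := by
    filter_upwards [htend.eventually (eventually_contDiffAt hφ)] with t ht
    exact ((ht.differentiableAt (by simp)).hasFDerivAt.comp_hasDerivAt t (hγ t)).deriv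
  have hdd : deriv (deriv (φ ∘ γ)) 0 = dirDeriv2 φ x u := by
    rw [hd.deriv_eq]
    have h1 := differentiableAt_of_smooth (contDiffAt_fderiv_apply hφ u)
    have h2 : HasFDerivAt (fun y => fderiv ℝ φ y u) (fderiv ℝ (fun y => fderiv ℝ φ y u) x) (γ 0) :=
      hγ0.symm ▸ h1.hasFDerivAt
    exact (h2.comp_hasDerivAt 0 (hγ 0)).deriv
  have hmax' : IsLocalMax (φ ∘ γ) 0 := by
    have := htend.eventually hmax
    filter_upwards [this] with t ht
    simpa [hγ0] using ht
  -- A positive second derivative would make the maximum also a strict-test minimum; the restriction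
  -- to the line is then locally constant, so its second derivative is zero.
  have hmin := isLocalMin_of_deriv_deriv_pos (by rw [hdd]; exact hpos) hmax'.deriv_eq_zero
    (ContinuousAt.comp (by rw [hγ0]; exact hφ.continuousAt) hcont.continuousAt)
  have hconst : φ ∘ γ =ᶠ[nhds 0] fun _ => φ (γ 0) := by
    filter_upwards [hmin, hmax'] with t h1 h2 using le_antisymm h2 h1
  have h0 : deriv (φ ∘ γ) =ᶠ[nhds 0] fun _ => 0 := by
    filter_upwards [hconst.eventuallyEq_nhds] with t ht
    rw [ht.deriv_eq]; simp
  rw [← hdd, h0.deriv_eq] at hpos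
  simp at hpos

end Levi

/-! ### The Bochner inequality for sections satisfying Cauchy-Riemann equations -/

section Bochner

variable {V E : Type*} [NormedAddCommGroup V] [NormedSpace ℂ V]
  [NormedAddCommGroup E] [NormedSpace ℝ E]
  {G : E → E →L[ℝ] E →L[ℝ] ℝ} {Γ : E → E →L[ℝ] E →L[ℝ] E} {O : Set E}
  {F : V → E}

/-- The Hermitian inequality `|⟨τ, σ⟩|² ≤ |σ|² |τ|²` for `σ = a - √-1 b`, `τ = p - √-1 q` in the
complexification, where `⟨τ, σ⟩ = s - √-1 t`. The form is only assumed semidefinite, hence the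
separate null case. -/
theorem cauchySchwarz_pair {A : E →L[ℝ] E →L[ℝ] ℝ} (hs : ∀ a b, A a b = A b a)
    (hn : ∀ a, 0 ≤ A a a) (a b p q : E) :
    (A p a + A q b) ^ 2 + (A q a - A p b) ^ 2 ≤ (A a a + A b b) * (A p p + A q q) := by
  set s := A p a + A q b with hS
  set t := A q a - A p b with hT
  by_cases h0 : A a a + A b b = 0
  · have ha : A a a = 0 := by linarith [hn a, hn b]
    have hb : A b b = 0 := by linarith [hn a, hn b]
    have hz : ∀ c : E, A c c = 0 → ∀ d, A d c = 0 := by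
      intro c hc d
      have key : ∀ r : ℝ, 0 ≤ A d d + 2 * r * A d c := by
        intro r
        have := hn (d + r • c)
        simp only [map_add, map_smul, add_apply, smul_apply, smul_eq_mul, hc, hs c d] at this
        linarith
      by_contra hne
      -- This `r` gives the affine function of `key` the value `-1`.
      have := key (-(A d d + 1) / (2 * A d c))
      have e : 2 * (-(A d d + 1) / (2 * A d c)) * A d c = -(A d d + 1) := by field_simp
      linarith
    simp [hS, hT, hz a ha, hz b hb]
  · have hpos : 0 < A a a + A b b := lt_of_le_of_ne (add_nonneg (hn a) (hn b)) (Ne.symm h0)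
    set k := A a a + A b b
    -- These are the two components of `|σ|² τ - ⟨τ, σ⟩ σ`, which is orthogonal to `σ`.
    have n1 := hn (k • p - (s • a - t • b))
    have n2 := hn (k • q - (s • b + t • a))
    simp only [map_sub, map_add, map_smul, add_apply, sub_apply, smul_apply, smul_eq_mul,
      hs a p, hs b p, hs a q, hs b q, hs b a] at n1 n2
    have hk : k = A a a + A b b := rfl
    have : 0 ≤ k * (k * (A p p + A q q) - (s ^ 2 + t ^ 2)) := by
      have e : k * (k * (A p p + A q q) - (s ^ 2 + t ^ 2)) =
        k * (k * A p p) + k * (k * A q q) - 2 * k * (s * s + t * t) + k * (s ^ 2 + t ^ 2) := by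
        ring
      rw [e]
      nth_rewrite 5 [hk]
      nth_rewrite 3 [hS]
      nth_rewrite 3 [hT]
      linarith
    have := nonneg_of_mul_nonneg_right this hpos
    linarith

/-- The hypotheses `hcr`, `hcr'` say that `σ = a - √-1 b` satisfies `∇_{ū} σ = 0`. The Laplacian of
`log |σ|²` along the line of `u` is then `4⟨R a, b⟩ / |σ|²` plus a gradient term that is
non-negative by Cauchy-Schwarz. -/
theorem dirDeriv2_log_pairing_nonneg (hL : IsLeviCivitaOn G Γ O) {x : V} (hx : F x ∈ O)
    (hF : ContDiffAt ℝ ∞ F x) {a b : V → E} (ha : ContDiffAt ℝ ∞ a x)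
    (hb : ContDiffAt ℝ ∞ b x) (u : V)
    (hcr : ∀ᶠ y in nhds x, covDeriv Γ F (Complex.I • u) a y = covDeriv Γ F u b y)
    (hcr' : ∀ᶠ y in nhds x, covDeriv Γ F (Complex.I • u) b y = -covDeriv Γ F u a y)
    (hR : 0 ≤ G (F x) (curvOp Γ (F x) (fderiv ℝ F x u) (fderiv ℝ F x (Complex.I • u)) (a x)) (b x))
    (hpos : 0 < G (F x) (a x) (a x) + G (F x) (b x) (b x)) :
    0 ≤ dirDeriv2 (fun y => Real.log (G (F y) (a y) (a y) + G (F y) (b y) (b y))) x u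
      + dirDeriv2 (fun y => Real.log (G (F y) (a y) (a y) + G (F y) (b y) (b y))) x
        (Complex.I • u) := by
  have hpa := hL.pairing_smooth hx hF ha ha
  have hpb := hL.pairing_smooth hx hF hb hb
  have hh := hpa.add hpb
  have hΓ := hL.smooth_symbol _ hx
  have hsy := hL.metric_symm _ hx
  have h2 : ∀ v, dirDeriv2 (fun y => G (F y) (a y) (a y) + G (F y) (b y) (b y)) x v
      = 2 * G (F x) (covDeriv Γ F v (covDeriv Γ F v a) x) (a x)
        + 2 * G (F x) (covDeriv Γ F v a x) (covDeriv Γ F v a x)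
        + 2 * G (F x) (covDeriv Γ F v (covDeriv Γ F v b) x) (b x)
        + 2 * G (F x) (covDeriv Γ F v b x) (covDeriv Γ F v b x) := by
    intro v
    have hev : (fun y => fderiv ℝ (fun y => G (F y) (a y) (a y) + G (F y) (b y) (b y)) y v)
        =ᶠ[nhds x] fun y => fderiv ℝ (fun y => G (F y) (a y) (a y)) y v
          + fderiv ℝ (fun y => G (F y) (b y) (b y)) y v := by
      filter_upwards [eventually_contDiffAt hpa, eventually_contDiffAt hpb] with y h1 h2
      rw [fderiv_fun_add (h1.differentiableAt (by simp)) (h2.differentiableAt (by simp)),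
        add_apply]
    rw [dirDeriv2, hev.fderiv_eq, fderiv_fun_add
      (differentiableAt_of_smooth (contDiffAt_fderiv_apply hpa v))
      (differentiableAt_of_smooth (contDiffAt_fderiv_apply hpb v)), add_apply,
      hL.fderiv_fderiv_pairing hx hF ha ha, hL.fderiv_fderiv_pairing hx hF hb hb,
      hsy (a x), hsy (b x)]
    ring
  have h1 : ∀ v, fderiv ℝ (fun y => G (F y) (a y) (a y) + G (F y) (b y) (b y)) x v
      = 2 * G (F x) (covDeriv Γ F v a x) (a x) + 2 * G (F x) (covDeriv Γ F v b x) (b x) := by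
    intro v
    have hFd := differentiableAt_of_smooth hF
    have had := differentiableAt_of_smooth ha
    have hbd := differentiableAt_of_smooth hb
    rw [fderiv_fun_add (differentiableAt_of_smooth hpa) (differentiableAt_of_smooth hpb),
      add_apply, hL.fderiv_pairing hx hFd had had, hL.fderiv_pairing hx hFd hbd hbd,
      hsy (a x), hsy (b x)]
    ring
  rw [dirDeriv2_log hh hpos, dirDeriv2_log hh hpos, h1, h1, h2, h2]
  -- The Cauchy-Riemann equations turn these commutators into the sums of second derivatives in the
  -- Laplacian, up to sign, so only curvature survives.
  have c1 := covDeriv_comm hΓ hF ha u (Complex.I • u)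
  have c2 := covDeriv_comm hΓ hF hb u (Complex.I • u)
  rw [covDeriv_congr (Γ := Γ) (F := F) hcr u] at c1
  rw [covDeriv_congr (Γ := Γ) (F := F) hcr' u, covDeriv_neg] at c2
  have d1 : covDeriv Γ F (Complex.I • u) (covDeriv Γ F (Complex.I • u) a) x
      = covDeriv Γ F (Complex.I • u) (covDeriv Γ F u b) x := covDeriv_congr hcr _
  have d2 : covDeriv Γ F (Complex.I • u) (covDeriv Γ F (Complex.I • u) b) x
      = -covDeriv Γ F (Complex.I • u) (covDeriv Γ F u a) x := by
    rw [← covDeriv_neg]; exact covDeriv_congr hcr' _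
  rw [d1, d2, hcr.self_of_nhds, hcr'.self_of_nhds]
  have c1' := congrArg (fun t => G (F x) t (b x)) c1
  have c2' := congrArg (fun t => G (F x) t (a x)) c2
  simp only [map_sub, map_neg, sub_apply, neg_apply] at c1' c2' ⊢
  have sk := hL.curv_skew_pairing hx (fderiv ℝ F x u) (fderiv ℝ F x (Complex.I • u)) (a x) (b x)
  have cs := cauchySchwarz_pair hsy (hL.metric_nonneg _ hx) (a x) (b x)
    (covDeriv Γ F u a x) (covDeriv Γ F u b x)
  set h := G (F x) (a x) (a x) + G (F x) (b x) (b x)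
  rw [div_sub_div _ _ hpos.ne' (by positivity), div_sub_div _ _ hpos.ne' (by positivity),
    ← add_div]
  apply div_nonneg _ (by positivity)
  generalize G (F x) (covDeriv Γ F u a x) (a x) = α1 at *
  generalize G (F x) (covDeriv Γ F u b x) (b x) = α2 at *
  generalize G (F x) (covDeriv Γ F u a x) (b x) = α3 at *
  generalize G (F x) (covDeriv Γ F u b x) (a x) = α4 at *
  generalize G (F x) (covDeriv Γ F u a x) (covDeriv Γ F u a x) = α5 at *
  generalize G (F x) (covDeriv Γ F u b x) (covDeriv Γ F u b x) = α6 at *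
  generalize G (F x) (curvOp Γ (F x) (fderiv ℝ F x u) (fderiv ℝ F x (Complex.I • u)) (a x))
    (b x) = r at *
  generalize G (F x) (covDeriv Γ F u (covDeriv Γ F u a) x) (a x) = β1 at *
  generalize G (F x) (covDeriv Γ F u (covDeriv Γ F u b) x) (b x) = β2 at *
  generalize G (F x) (covDeriv Γ F (Complex.I • u) (covDeriv Γ F u b) x) (a x) = β3 at *
  generalize G (F x) (covDeriv Γ F (Complex.I • u) (covDeriv Γ F u a) x) (b x) = β4 at *
  have e1 : β1 = r - β3 := by linarith
  have e2 : β2 = r + β4 := by linarith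
  rw [e1, e2]
  have : 0 ≤ h * (h * (4 * r) + 4 * (h * (α5 + α6) - ((α1 + α2) ^ 2 + (α4 - α3) ^ 2))) := by
    have := mul_nonneg hpos.le hR
    exact mul_nonneg hpos.le (by linarith)
  refine this.trans_eq ?_
  ring

end Bochner

/-! ### Plurisubharmonicity of the logarithm of the energy on the tangent bundle -/

section TangentLift

variable {V V' E : Type*} [NormedAddCommGroup V] [NormedSpace ℂ V]
  [NormedAddCommGroup V'] [NormedSpace ℂ V']
  [NormedAddCommGroup E] [NormedSpace ℝ E]
  {G : E → E →L[ℝ] E →L[ℝ] ℝ} {Γ : E → E →L[ℝ] E →L[ℝ] E} {O : Set E}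
  {F : V → E} {U : Set V}

/-- Twice the squared length of the complexified differential of `F` at `x` on the `(1,0)`-part
of `v`. -/
def energyForm (G : E → E →L[ℝ] E →L[ℝ] ℝ) (F : V → E) (x v : V) : ℝ :=
  G (F x) (fderiv ℝ F x v) (fderiv ℝ F x v)
    + G (F x) (fderiv ℝ F x (Complex.I • v)) (fderiv ℝ F x (Complex.I • v))

namespace IsRealPluriharmonicOn

theorem tangent_field_smooth (hF : IsRealPluriharmonicOn Γ O F U) {P : V' →L[ℂ] V} {W : V' → V}
    (hW : ContDiff ℝ ∞ W) {q : V'} (hq : P q ∈ U) :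
    ContDiffAt ℝ ∞ (fun t => fderiv ℝ F (P t) (W t)) q := by
  have hP : ContDiffAt ℝ ∞ P q := (P.restrictScalars ℝ).contDiff.contDiffAt
  exact ((contDiffAt_fderiv (hF.smooth _ hq)).comp q hP).clm_apply hW.contDiffAt

theorem energyForm_smooth (hF : IsRealPluriharmonicOn Γ O F U) (hL : IsLeviCivitaOn G Γ O)
    {P : V' →L[ℂ] V} {W : V' → V} (hW : ContDiff ℝ ∞ W) {q : V'} (hq : P q ∈ U) :
    ContDiffAt ℝ ∞ (fun t => energyForm G F (P t) (W t)) q := by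
  have hP : ContDiffAt ℝ ∞ P q := (P.restrictScalars ℝ).contDiff.contDiffAt
  have hIW : ContDiff ℝ ∞ (fun t => Complex.I • W t) := contDiff_const.smul hW
  have ha := hF.tangent_field_smooth hW hq
  have hb := hF.tangent_field_smooth hIW hq
  have hFP : ContDiffAt ℝ ∞ (fun t => F (P t)) q := (hF.smooth _ hq).comp q hP
  have hO : F (P q) ∈ O := hF.mapsTo _ hq
  exact (hL.pairing_smooth (F := fun t => F (P t)) hO hFP ha ha).add
    (hL.pairing_smooth (F := fun t => F (P t)) hO hFP hb hb)

/-- `P` is the base-point projection and `W` a vector varying holomorphically. Moving the vector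
contributes `dF(W' u)`; as `W'` is complex linear, this extra term respects the Cauchy-Riemann
equations. -/
theorem covDeriv_tangent_field (hF : IsRealPluriharmonicOn Γ O F U) {P : V' →L[ℂ] V}
    {W : V' → V} {W' : V' →L[ℂ] V} {q : V'} (hW : HasFDerivAt W (W'.restrictScalars ℝ) q)
    (hq : P q ∈ U) (u : V') :
    covDeriv Γ (fun t => F (P t)) u (fun t => fderiv ℝ F (P t) (W t)) q
      = covDeriv Γ F (P u) (fun y => fderiv ℝ F y (W q)) (P q) + fderiv ℝ F (P q) (W' u) := by
  have hs := hF.smooth _ hq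
  have hP : HasFDerivAt P (P.restrictScalars ℝ) q := (P.restrictScalars ℝ).hasFDerivAt
  have h1 := ((differentiableAt_of_smooth (contDiffAt_fderiv hs)).hasFDerivAt.comp q
    hP).clm_apply hW
  have h1' : fderiv ℝ (fun t => fderiv ℝ F (P t) (W t)) q = _ := h1.fderiv
  have h2 := (differentiableAt_of_smooth hs).hasFDerivAt.comp q hP
  have h2' : fderiv ℝ (fun t => F (P t)) q = _ := h2.fderiv
  simp only [covDeriv, h1', h2', fderiv_fderiv_apply hs]
  simp
  abel

/-- The logarithm of the energy form is plurisubharmonic on the tangent bundle where it is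
positive. -/
theorem dirDeriv2_log_energyForm_nonneg (hF : IsRealPluriharmonicOn Γ O F U)
    (hL : IsLeviCivitaOn G Γ O)
    (hneg : ∀ y ∈ O, ∀ X Y, 0 ≤ G y (curvOp Γ y X Y X) Y)
    {P : V' →L[ℂ] V} {W : V' → V} {W' : V' →L[ℂ] V} (hWs : ContDiff ℝ ∞ W)
    (hW : ∀ q, HasFDerivAt W (W'.restrictScalars ℝ) q) {q : V'} (hq : P q ∈ U)
    (hpos : 0 < energyForm G F (P q) (W q)) (u : V') :
    0 ≤ dirDeriv2 (fun t => Real.log (energyForm G F (P t) (W t))) q u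
      + dirDeriv2 (fun t => Real.log (energyForm G F (P t) (W t))) q (Complex.I • u) := by
  have hP : ContDiffAt ℝ ∞ P q := (P.restrictScalars ℝ).contDiff.contDiffAt
  have hIW : ContDiff ℝ ∞ (fun t => Complex.I • W t) := contDiff_const.smul hWs
  have ha := hF.tangent_field_smooth hWs hq
  have hb := hF.tangent_field_smooth hIW hq
  have hIW' : ∀ q, HasFDerivAt (fun t => Complex.I • W t)
      ((Complex.I • W').restrictScalars ℝ) q := fun q => by
    have := (((Complex.I • ContinuousLinearMap.id ℂ V).restrictScalars ℝ).hasFDerivAt).comp q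
      (hW q)
    exact this
  have hFP : ContDiffAt ℝ ∞ (fun t => F (P t)) q := (hF.smooth _ hq).comp q hP
  have hO : F (P q) ∈ O := hF.mapsTo _ hq
  have hev : ∀ᶠ t in nhds q, P t ∈ U := hP.continuousAt.eventually (hF.isOpen.mem_nhds hq)
  refine dirDeriv2_log_pairing_nonneg (F := fun t => F (P t)) hL hO hFP ha hb u ?_ ?_ ?_ hpos
  · filter_upwards [hev] with t ht
    rw [hF.covDeriv_tangent_field (hW t) ht, hF.covDeriv_tangent_field (hIW' t) ht, map_smul,
      map_smul, hF.covDeriv_I_smul ht]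
    rfl
  · filter_upwards [hev] with t ht
    rw [hF.covDeriv_tangent_field (hW t) ht, hF.covDeriv_tangent_field (hIW' t) ht, map_smul,
      map_smul, neg_add, ← eq_neg_of_add_eq_zero_right (hF.eq_zero _ ht _ _), smul_apply,
      I_smul_I_smul, map_neg]
  · have h2 := (differentiableAt_of_smooth (hF.smooth _ hq)).hasFDerivAt.comp q
      (P.restrictScalars ℝ).hasFDerivAt
    have h2' : fderiv ℝ (fun t => F (P t)) q = _ := h2.fderiv
    rw [h2']
    simpa using hF.curvature_nonneg hL hneg hq (P u) (W q)

end IsRealPluriharmonicOn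

end TangentLift

/-! ### Comparison with the index formulas for curvature -/

section Coordinates

variable {E : Type*} [NormedAddCommGroup E] [NormedSpace ℝ E]
  {ι : Type*} [Fintype ι]
  {G : E → E →L[ℝ] E →L[ℝ] ℝ} {Γ : E → E →L[ℝ] E →L[ℝ] E} {O : Set E}

namespace IsLeviCivitaOn

variable {b : Module.Basis ι ℝ E} {g : E → Matrix ι ι ℝ}

theorem metric_expand (hg : ∀ y ∈ O, ∀ i j, g y i j = G y (b i) (b j)) {y : E} (hy : y ∈ O)
    (X Y : ι → ℝ) :
    G y (∑ i, X i • b i) (∑ j, Y j • b j) = ∑ i, ∑ j, g y i j * X i * Y j := by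
  simp only [map_sum, map_smul, sum_apply, smul_apply, smul_eq_mul, hg y hy]
  rw [Finset.sum_comm]
  refine Finset.sum_congr rfl fun i _ => ?_
  rw [Finset.mul_sum]
  exact Finset.sum_congr rfl fun j _ => by ring

variable [DecidableEq ι]

theorem isUnit_det (hpd : ∀ y ∈ O, ∀ a, a ≠ 0 → 0 < G y a a)
    (hg : ∀ y ∈ O, ∀ i j, g y i j = G y (b i) (b j)) {y : E} (hy : y ∈ O) :
    IsUnit (g y).det := by
  rw [isUnit_iff_ne_zero]
  intro h0
  obtain ⟨v, hv, hv0⟩ := Matrix.exists_mulVec_eq_zero_iff.2 h0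
  have hne : (∑ i, v i • b i) ≠ 0 := by
    intro h
    apply hv
    funext i
    exact (Fintype.linearIndependent_iff.1 b.linearIndependent) v h i
  have := hpd y hy _ hne
  rw [metric_expand hg hy] at this
  have hz : ∑ i, ∑ j, g y i j * v i * v j = 0 := by
    refine Finset.sum_eq_zero fun i _ => ?_
    have := congrFun hv0 i
    simp only [Matrix.mulVec, dotProduct, Pi.zero_apply] at this
    rw [← zero_mul (v i), ← this, Finset.sum_mul]
    exact Finset.sum_congr rfl fun j _ => by ring
  linarith

/-- Koszul's formula: metric compatibility and symmetry of `Γ` reduce the combination of derivatives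
to `2⟨Γ(b_i, b_j), b_l⟩`, and the inverse Gram matrix recovers the components. -/
theorem leviCivita_eq (h : IsLeviCivitaOn G Γ O) (hpd : ∀ y ∈ O, ∀ a, a ≠ 0 → 0 < G y a a)
    (hg : ∀ y ∈ O, ∀ i j, g y i j = G y (b i) (b j)) {y : E} (hy : y ∈ O) (k i j : ι) :
    leviCivita b g k i j y = b.repr (Γ y (b i) (b j)) k := by
  have hd : ∀ i j v, fderiv ℝ (fun t => g t i j) y v
      = G y (Γ y v (b i)) (b j) + G y (b i) (Γ y v (b j)) := by
    intro i j v
    have e : (fun t => g t i j) =ᶠ[nhds y] fun t => G t (b i) (b j) := by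
      filter_upwards [h.isOpen.mem_nhds hy] with t ht using hg t ht i j
    have hs := (differentiableAt_of_smooth (h.smooth_metric _ hy)).hasFDerivAt
    have := ((hs.clm_apply (hasFDerivAt_const (b i) y)).clm_apply
      (hasFDerivAt_const (b j) y)).fderiv
    rw [e.fderiv_eq, this, ← h.compat y hy]
    simp
  have hsum : ∀ l, fderiv ℝ (fun y => g y j l) y (b i) + fderiv ℝ (fun y => g y i l) y (b j)
      - fderiv ℝ (fun y => g y i j) y (b l) = 2 * G y (Γ y (b i) (b j)) (b l) := by
    intro l
    rw [hd, hd, hd, h.symbol_symm y hy (b l) (b i), h.symbol_symm y hy (b l) (b j),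
      h.symbol_symm y hy (b j) (b i), h.metric_symm y hy (b j) (Γ y (b i) (b l))]
    ring
  have hrep : ∀ l, G y (Γ y (b i) (b j)) (b l)
      = ∑ p, g y l p * b.repr (Γ y (b i) (b j)) p := by
    intro l
    conv_lhs => rw [← b.sum_repr (Γ y (b i) (b j))]
    simp only [map_sum, map_smul, sum_apply, smul_apply, smul_eq_mul, hg y hy]
    exact Finset.sum_congr rfl fun p _ => by rw [h.metric_symm y hy]; ring
  have hmv : (fun l => G y (Γ y (b i) (b j)) (b l))
      = Matrix.mulVec (g y) (fun p => b.repr (Γ y (b i) (b j)) p) := by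
    funext l; rw [hrep]; rfl
  have hinv : Matrix.mulVec (g y)⁻¹ (fun l => G y (Γ y (b i) (b j)) (b l))
      = fun p => b.repr (Γ y (b i) (b j)) p := by
    rw [hmv, Matrix.mulVec_mulVec, Matrix.nonsing_inv_mul _ (isUnit_det hpd hg hy),
      Matrix.one_mulVec]
  rw [← congrFun hinv k, leviCivita]
  simp only [hsum, Matrix.mulVec, dotProduct, Finset.mul_sum]
  exact Finset.sum_congr rfl fun p _ => by ring

theorem riemann_eq (h : IsLeviCivitaOn G Γ O) (hpd : ∀ y ∈ O, ∀ a, a ≠ 0 → 0 < G y a a)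
    (hg : ∀ y ∈ O, ∀ i j, g y i j = G y (b i) (b j)) {y : E} (hy : y ∈ O) (i j k l : ι) :
    riemann b g i j k l y = b.repr (curvOp Γ y (b i) (b j) (b k)) l := by
  have : FiniteDimensional ℝ E := b.finiteDimensional_of_finite
  have hs := (differentiableAt_of_smooth (h.smooth_symbol _ hy)).hasFDerivAt
  have hd : ∀ i k j, fderiv ℝ (leviCivita b g l k j) y (b i)
      = b.repr (fderiv ℝ Γ y (b i) (b j) (b k)) l := by
    intro i k j
    have e : leviCivita b g l k j =ᶠ[nhds y] fun t => (b.coord l).toContinuousLinearMap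
        (Γ t (b j) (b k)) := by
      filter_upwards [h.isOpen.mem_nhds hy] with t ht
      rw [h.leviCivita_eq hpd hg ht, h.symbol_symm t ht]
      rfl
    have h1 := ((hs.clm_apply (hasFDerivAt_const (b j) y)).clm_apply
      (hasFDerivAt_const (b k) y))
    have h2 := ((b.coord l).toContinuousLinearMap.hasFDerivAt.comp y h1).fderiv
    rw [e.fderiv_eq]
    refine (DFunLike.congr_fun h2 (b i)).trans ?_
    simp
  have hq : ∀ i j k, ∑ p, leviCivita b g p k j y * leviCivita b g l p i y
      = b.repr (Γ y (b i) (Γ y (b j) (b k))) l := by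
    intro i j k
    conv_rhs => rw [← b.sum_repr (Γ y (b j) (b k))]
    simp only [map_sum, map_smul, Finsupp.coe_finsetSum, Finset.sum_apply, Finsupp.smul_apply,
      smul_eq_mul]
    refine Finset.sum_congr rfl fun p _ => ?_
    rw [h.leviCivita_eq hpd hg hy, h.leviCivita_eq hpd hg hy, h.symbol_symm y hy (b k),
      h.symbol_symm y hy (b p)]
  rw [riemann, hd, hd, Finset.sum_sub_distrib, hq, hq, curvOp]
  simp only [map_sub, map_add, Finsupp.sub_apply, Finsupp.add_apply]
  ring

theorem riemannLow_expand (h : IsLeviCivitaOn G Γ O)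
    (hpd : ∀ y ∈ O, ∀ a, a ≠ 0 → 0 < G y a a)
    (hg : ∀ y ∈ O, ∀ i j, g y i j = G y (b i) (b j)) {y : E} (hy : y ∈ O) (X Y : ι → ℝ) :
    ∑ i, ∑ j, ∑ k, ∑ l, riemannLow b g i j k l y * X i * Y j * Y k * X l
      = G y (curvOp Γ y (∑ i, X i • b i) (∑ i, Y i • b i) (∑ i, Y i • b i)) (∑ i, X i • b i) := by
  have hlow : ∀ i j k l, riemannLow b g i j k l y = G y (curvOp Γ y (b i) (b j) (b k)) (b l) := by
    intro i j k l
    conv_rhs => rw [← b.sum_repr (curvOp Γ y (b i) (b j) (b k))]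
    simp only [map_sum, map_smul, sum_apply, smul_apply, smul_eq_mul, riemannLow,
      h.riemann_eq hpd hg hy, hg y hy]
    exact Finset.sum_congr rfl fun p _ => by ring
  have c1 : ∀ B C, curvOp Γ y (∑ i, X i • b i) B C = ∑ i, X i • curvOp Γ y (b i) B C := by
    intro B C
    simp only [curvOp, map_sum, map_smul, sum_apply, smul_apply, smul_sub,
      smul_add, Finset.sum_sub_distrib, Finset.sum_add_distrib]
  have c2 : ∀ B C, curvOp Γ y B (∑ i, Y i • b i) C = ∑ i, Y i • curvOp Γ y B (b i) C := by
    intro B C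
    simp only [curvOp, map_sum, map_smul, sum_apply, smul_apply, smul_sub,
      smul_add, Finset.sum_sub_distrib, Finset.sum_add_distrib]
  have c3 : ∀ B C, curvOp Γ y B C (∑ i, Y i • b i) = ∑ i, Y i • curvOp Γ y B C (b i) := by
    intro B C
    simp only [curvOp, map_sum, map_smul, smul_sub,
      smul_add, Finset.sum_sub_distrib, Finset.sum_add_distrib]
  have hW : ∀ A, G y A (∑ l, X l • b l) = ∑ l, X l * G y A (b l) := by
    intro A; simp only [map_sum, map_smul, smul_eq_mul]
  generalize (∑ l, X l • b l) = W at hW c1 ⊢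
  rw [c1, map_sum, sum_apply]
  refine Finset.sum_congr rfl fun i _ => ?_
  rw [map_smul, smul_apply, c2, map_sum, sum_apply, Finset.smul_sum]
  refine Finset.sum_congr rfl fun j _ => ?_
  rw [map_smul, smul_apply, c3, map_sum, sum_apply, Finset.smul_sum, Finset.smul_sum]
  refine Finset.sum_congr rfl fun k _ => ?_
  rw [map_smul, smul_apply, hW, Finset.smul_sum, Finset.smul_sum, Finset.smul_sum]
  refine Finset.sum_congr rfl fun l _ => ?_
  simp only [smul_eq_mul, hlow]
  ring

/-- Non-positive sectional curvature, as an inequality for the curvature operator. -/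
theorem curvOp_nonneg (h : IsLeviCivitaOn G Γ O)
    (hpd : ∀ y ∈ O, ∀ a, a ≠ 0 → 0 < G y a a)
    (hg : ∀ y ∈ O, ∀ i j, g y i j = G y (b i) (b j)) {y : E} (hy : y ∈ O)
    (hsec : ∀ X Y : ι → ℝ, LinearIndependent ℝ ![X, Y] → sectionalCurvature b g y X Y ≤ 0)
    (X Y : E) : 0 ≤ G y (curvOp Γ y X Y X) Y := by
  rw [h.curv_skew_pairing hy, neg_nonneg]
  by_cases hX : X = 0
  · simp [hX]
  -- Dependent vectors span no plane, so `hsec` says nothing; antisymmetry of the curvature gives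
  -- zero.
  by_cases hdep : ∃ c : ℝ, c • X = Y
  · obtain ⟨c, rfl⟩ := hdep
    simp [curvOp]
  push Not at hdep
  have hXs := b.sum_repr X
  have hYs := b.sum_repr Y
  have hli : LinearIndependent ℝ ![(⇑(b.repr X) : ι → ℝ), ⇑(b.repr Y)] := by
    rw [LinearIndependent.pair_iff' (by simpa using hX)]
    intro c hc
    apply hdep c
    apply b.repr.injective
    ext i
    simpa using congrFun hc i
  have hs := hsec _ _ hli
  have hden : 0 < G y X X * G y Y Y - G y X Y ^ 2 := by
    have hXX := hpd y hy X hX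
    have hZ : G y X X • Y - G y X Y • X ≠ 0 := by
      intro hz
      apply hdep ((G y X X)⁻¹ * G y X Y)
      rw [mul_smul, ← sub_eq_zero.1 hz, smul_smul, inv_mul_cancel₀ hXX.ne', one_smul]
    have := hpd y hy _ hZ
    simp only [map_sub, map_smul, sub_apply, smul_apply, smul_eq_mul,
      h.metric_symm y hy Y X] at this
    have e : 0 < G y X X * (G y X X * G y Y Y - G y X Y ^ 2) := by linarith
    exact (mul_pos_iff_of_pos_left hXX).1 e
  rw [sectionalCurvature, h.riemannLow_expand hpd hg hy, metricPairing, metricPairing,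
    metricPairing, ← metric_expand hg hy, ← metric_expand hg hy, ← metric_expand hg hy, hXs, hYs,
    div_le_iff₀ hden, zero_mul] at hs
  exact hs

end IsLeviCivitaOn

end Coordinates

/-! ### Wirtinger derivatives and smoothness of the inverse matrix -/

section Wirtinger

variable {V : Type*} [NormedAddCommGroup V] [NormedSpace ℂ V]

theorem fderiv_eq_dz_add_dzbar (c : V → ℂ) (x v : V) :
    fderiv ℝ c x v = dz c x v + dzbar c x v := by
  simp only [dz, dzbar]; ring

theorem real_map_smul {W : Type*} [NormedAddCommGroup W] [NormedSpace ℝ W] (L : V →L[ℝ] W)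
    (α : ℂ) (v : V) : L (α • v) = α.re • L v + α.im • L (Complex.I • v) := by
  conv_lhs => rw [← Complex.re_add_im α, add_smul, mul_smul]
  rw [map_add, Complex.coe_smul, Complex.coe_smul, map_smul, map_smul]

theorem real_map_I_smul_smul {W : Type*} [NormedAddCommGroup W] [NormedSpace ℝ W] (L : V →L[ℝ] W)
    (α : ℂ) (v : V) : L (Complex.I • α • v) = α.re • L (Complex.I • v) - α.im • L v := by
  rw [smul_smul, real_map_smul]
  simp [sub_eq_neg_add]

/-- The Wirtinger derivative is complex linear in the direction. -/
def dzLinear (c : V → ℂ) (x : V) : V →ₗ[ℂ] ℂ where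
  toFun := dz c x
  map_add' u v := by simp only [dz, smul_add, map_add]; ring
  map_smul' α v := by
    rw [dz, dz, real_map_I_smul_smul (fderiv ℝ c x) α v, real_map_smul (fderiv ℝ c x) α v,
      RingHom.id_apply, smul_eq_mul]
    simp only [Complex.real_smul]
    conv_rhs => rw [← Complex.re_add_im α]
    linear_combination ((1 / 2 : ℂ) * α.im * fderiv ℝ c x (Complex.I • v)) * Complex.I_sq

theorem dzbar_eq_star (c : V → ℂ) (x v : V) :
    dzbar c x v = star (dz (fun t => star (c t)) x v) := by
  have h : fderiv ℝ (fun t => star (c t)) x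
      = (Complex.conjCLE : ℂ →L[ℝ] ℂ).comp (fderiv ℝ c x) := Complex.conjCLE.comp_fderiv
  rw [dz, dzbar, h]
  simp

theorem dz_smooth {c : V → ℂ} {x : V} (hc : ContDiffAt ℝ ∞ c x) (v : V) :
    ContDiffAt ℝ ∞ (fun y => dz c y v) x :=
  contDiffAt_const.mul ((contDiffAt_fderiv_apply hc v).sub
    (contDiffAt_const.mul (contDiffAt_fderiv_apply hc _)))

end Wirtinger

section Matrix

theorem sum_smul_coordVec {n : ℕ} (v : CSpace n) : ∑ j, v j • coordVec j = v := by
  ext i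
  simp [coordVec, Pi.single_apply]

theorem contDiffAt_det {V : Type*} [NormedAddCommGroup V] [NormedSpace ℝ V] {ι : Type*}
    [Fintype ι] [DecidableEq ι] {A : V → Matrix ι ι ℂ} {x : V}
    (hA : ∀ i j, ContDiffAt ℝ ∞ (fun y => A y i j) x) :
    ContDiffAt ℝ ∞ (fun y => (A y).det) x := by
  simp only [Matrix.det_apply']
  exact ContDiffAt.sum fun σ _ => contDiffAt_const.mul (contDiffAt_prod fun i _ => hA _ _)

theorem contDiffAt_inv_apply {V : Type*} [NormedAddCommGroup V] [NormedSpace ℝ V] {ι : Type*}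
    [Fintype ι] [DecidableEq ι] {A : V → Matrix ι ι ℂ} {x : V}
    (hA : ∀ i j, ContDiffAt ℝ ∞ (fun y => A y i j) x) (hdet : (A x).det ≠ 0) (i j : ι) :
    ContDiffAt ℝ ∞ (fun y => (A y)⁻¹ i j) x := by
  simp only [Matrix.inv_def, Ring.inverse_eq_inv', Matrix.smul_apply, smul_eq_mul,
    Matrix.adjugate_apply]
  refine ((contDiffAt_det hA).inv hdet).mul (contDiffAt_det fun k l => ?_)
  simp only [Matrix.updateRow_apply]
  split_ifs
  · exact contDiffAt_const
  · exact hA _ _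

end Matrix

/-! ### The Chern connection of a Kähler metric as its Levi-Civita connection -/

section Hermitian

variable {n : ℕ} {N : Type*} [TopologicalSpace N] [ChartedSpace (CSpace n) N]

theorem chartVec_smul (e : OpenPartialHomeomorph N (CSpace n)) (z : CSpace n) (c : ℂ)
    (v : CSpace n) : chartVec e z (c • v) = c • chartVec e z v :=
  (mfderiv 𝓘(ℂ, CSpace n) 𝓘(ℂ, CSpace n) e.symm z).map_smul c v

theorem chartVec_add (e : OpenPartialHomeomorph N (CSpace n)) (z : CSpace n)
    (u v : CSpace n) : chartVec e z (u + v) = chartVec e z u + chartVec e z v :=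
  (mfderiv 𝓘(ℂ, CSpace n) 𝓘(ℂ, CSpace n) e.symm z).map_add u v

theorem chartVec_bijective [IsManifold 𝓘(ℂ, CSpace n) ω N]
    {e : OpenPartialHomeomorph N (CSpace n)} (he : e ∈ atlas (CSpace n) N) {z : CSpace n}
    (hz : z ∈ e.target) : Function.Bijective (chartVec e z) := by
  have : IsManifold 𝓘(ℂ, CSpace n) 1 N := IsManifold.of_le (n := ω) le_top
  exact (mdifferentiable_of_mem_atlas (I := 𝓘(ℂ, CSpace n)) he).symm.mfderiv_bijective hz

namespace HermitianMetric

variable (g : HermitianMetric n N)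

theorem form_add_right (p : N) (u v w : TangentSpace 𝓘(ℂ, CSpace n) p) :
    g.form p u (v + w) = g.form p u v + g.form p u w := by
  rw [← g.conj_symm, g.add_left, star_add, g.conj_symm, g.conj_symm]

theorem form_smul_right (p : N) (c : ℂ) (u v : TangentSpace 𝓘(ℂ, CSpace n) p) :
    g.form p u (c • v) = star c * g.form p u v := by
  rw [← g.conj_symm, g.smul_left, star_mul', g.conj_symm]

/-- The Hermitian form in a chart. -/
def chartForm (e : OpenPartialHomeomorph N (CSpace n)) (z : CSpace n) (a b : CSpace n) : ℂ :=
  g.form (e.symm z) (chartVec e z a) (chartVec e z b)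

/-- The Hermitian form in a chart, as a sesquilinear map. -/
def chartSesq (e : OpenPartialHomeomorph N (CSpace n)) (z : CSpace n) :
    CSpace n →ₗ[ℂ] CSpace n →ₛₗ[starRingEnd ℂ] ℂ :=
  LinearMap.mk₂'ₛₗ (RingHom.id ℂ) (starRingEnd ℂ) (g.chartForm e z)
    (fun a b c => by simp only [chartForm, chartVec_add, g.add_left])
    (fun c a b => by simp only [chartForm, chartVec_smul, g.smul_left]; rfl)
    (fun a b c => by simp only [chartForm, chartVec_add, g.form_add_right])
    (fun c a b => by simp only [chartForm, chartVec_smul, g.form_smul_right]; rfl)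

theorem chartForm_expand (e : OpenPartialHomeomorph N (CSpace n)) (z a b : CSpace n) :
    g.chartForm e z a b = ∑ k, ∑ l, g.coeff e z k l * a k * star (b l) := by
  change g.chartSesq e z a b = _
  conv_lhs => rw [← sum_smul_coordVec a, ← sum_smul_coordVec b]
  simp only [map_sum, map_smul, LinearMap.map_smulₛₗ, LinearMap.sum_apply, LinearMap.smul_apply,
    smul_eq_mul]
  rw [Finset.sum_comm]
  refine Finset.sum_congr rfl fun l _ => ?_
  rw [Finset.mul_sum]
  refine Finset.sum_congr rfl fun k _ => ?_
  have : g.chartSesq e z (coordVec k) (coordVec l) = g.coeff e z k l := rfl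
  rw [this, starRingEnd_apply]
  ring

/-- The underlying Riemannian metric in a chart. -/
def chartMetric (e : OpenPartialHomeomorph N (CSpace n)) (z : CSpace n) :
    CSpace n →L[ℝ] CSpace n →L[ℝ] ℝ :=
  (LinearMap.mk₂ ℝ (fun a b => (g.chartForm e z a b).re)
    (fun a b c => by
      have := congrArg Complex.re (congrArg (fun t => t c) ((g.chartSesq e z).map_add a b))
      exact this)
    (fun r a b => by
      have h : g.chartForm e z ((r : ℂ) • a) b = r * g.chartForm e z a b :=
        congrArg (fun t => t b) ((g.chartSesq e z).map_smul (r : ℂ) a)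
      rw [Complex.coe_smul] at h
      rw [h, Complex.re_ofReal_mul, smul_eq_mul])
    (fun a b c => congrArg Complex.re ((g.chartSesq e z a).map_add b c))
    (fun r a b => by
      have h : g.chartForm e z a ((r : ℂ) • b) = starRingEnd ℂ r * g.chartForm e z a b :=
        (g.chartSesq e z a).map_smulₛₗ (r : ℂ) b
      rw [Complex.coe_smul, Complex.conj_ofReal] at h
      rw [h, Complex.re_ofReal_mul, smul_eq_mul])).toContinuousBilinearMap

theorem chartMetric_apply (e : OpenPartialHomeomorph N (CSpace n)) (z a b : CSpace n) :
    g.chartMetric e z a b = (g.chartForm e z a b).re := rfl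

/-- The Christoffel symbols of the Chern connection in a chart, as a bilinear map. -/
def chartSymbol (e : OpenPartialHomeomorph N (CSpace n)) (z : CSpace n) :
    CSpace n →L[ℝ] CSpace n →L[ℝ] CSpace n :=
  (LinearMap.mk₂ ℝ (fun v a => WithLp.toLp 2 fun i => ∑ j, ∑ k, g.chernSymbol e i j k z * v j * a k)
    (fun a b c => by
      ext i
      simp [mul_add, add_mul, Finset.sum_add_distrib])
    (fun r a b => by
      ext i
      simp only [PiLp.smul_apply, Complex.real_smul, Finset.mul_sum]
      exact Finset.sum_congr rfl fun _ _ => Finset.sum_congr rfl fun _ _ => by ring)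
    (fun a b c => by
      ext i
      simp [mul_add, Finset.sum_add_distrib])
    (fun r a b => by
      ext i
      simp only [PiLp.smul_apply, Complex.real_smul, Finset.mul_sum]
      exact Finset.sum_congr rfl fun _ _ => Finset.sum_congr rfl fun _ _ => by ring)
    ).toContinuousBilinearMap

theorem chartSymbol_apply (e : OpenPartialHomeomorph N (CSpace n)) (z v a : CSpace n)
    (i : Fin n) : g.chartSymbol e z v a i = ∑ j, ∑ k, g.chernSymbol e i j k z * v j * a k := rfl

variable {g} {e : OpenPartialHomeomorph N (CSpace n)}

theorem coeff_smooth (he : e ∈ atlas (CSpace n) N) {z : CSpace n} (hz : z ∈ e.target)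
    (k l : Fin n) : ContDiffAt ℝ ∞ (fun y => g.coeff e y k l) z :=
  (g.smooth e he k l).contDiffAt (e.open_target.mem_nhds hz)

theorem coeff_star (z : CSpace n) (k l : Fin n) : star (g.coeff e z k l) = g.coeff e z l k :=
  g.conj_symm _ _ _

theorem chartMetric_pos [IsManifold 𝓘(ℂ, CSpace n) ω N] (he : e ∈ atlas (CSpace n) N)
    {z : CSpace n} (hz : z ∈ e.target) {a : CSpace n} (ha : a ≠ 0) :
    0 < g.chartMetric e z a a := by
  apply g.re_pos
  intro h0
  apply ha
  apply (chartVec_bijective he hz).1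
  rw [h0]
  exact ((mfderiv 𝓘(ℂ, CSpace n) 𝓘(ℂ, CSpace n) e.symm z).map_zero).symm

theorem coeff_det_ne_zero [IsManifold 𝓘(ℂ, CSpace n) ω N] (he : e ∈ atlas (CSpace n) N)
    {z : CSpace n} (hz : z ∈ e.target) : (g.coeff e z).det ≠ 0 := by
  intro h0
  obtain ⟨v, hv, hv0⟩ := Matrix.exists_vecMul_eq_zero_iff.2 h0
  have hne : (WithLp.toLp 2 v : CSpace n) ≠ 0 := by
    intro h; apply hv; funext i; exact congrFun (congrArg WithLp.ofLp h) i
  have hpos := chartMetric_pos (g := g) he hz hne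
  rw [chartMetric_apply, chartForm_expand, Finset.sum_comm] at hpos
  have : ∑ l, ∑ k, g.coeff e z k l * v k * star (v l) = 0 := by
    refine Finset.sum_eq_zero fun l _ => ?_
    have := congrFun hv0 l
    simp only [Matrix.vecMul, dotProduct, Pi.zero_apply] at this
    rw [← Finset.sum_mul, ← zero_mul (star (v l)), ← this]
    congr 1
    exact Finset.sum_congr rfl fun j _ => by ring
  have h2 := hpos.ne'
  exact h2 (by simpa using congrArg Complex.re this)

theorem chernSymbol_smooth [IsManifold 𝓘(ℂ, CSpace n) ω N] (he : e ∈ atlas (CSpace n) N)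
    {z : CSpace n} (hz : z ∈ e.target) (i j k : Fin n) :
    ContDiffAt ℝ ∞ (g.chernSymbol e i j k) z :=
  ContDiffAt.sum fun l _ => (contDiffAt_inv_apply (coeff_smooth he hz)
    (coeff_det_ne_zero he hz) l i).mul (dz_smooth (coeff_smooth he hz k l) _)

theorem sum_chernSymbol_mul_coeff [IsManifold 𝓘(ℂ, CSpace n) ω N]
    (he : e ∈ atlas (CSpace n) N) {z : CSpace n} (hz : z ∈ e.target) (j k m : Fin n) :
    ∑ i, g.chernSymbol e i j k z * g.coeff e z i m
      = dz (fun y => g.coeff e y k m) z (coordVec j) := by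
  simp only [chernSymbol, Finset.sum_mul]
  rw [Finset.sum_comm]
  have h := Matrix.nonsing_inv_mul _ (isUnit_iff_ne_zero.2 (coeff_det_ne_zero (g := g) he hz))
  have h2 : ∀ l, ∑ i, (g.coeff e z)⁻¹ l i * dz (fun y => g.coeff e y k l) z (coordVec j)
      * g.coeff e z i m = dz (fun y => g.coeff e y k l) z (coordVec j)
        * (1 : Matrix (Fin n) (Fin n) ℂ) l m := by
    intro l
    rw [← h, Matrix.mul_apply, Finset.mul_sum]
    exact Finset.sum_congr rfl fun i _ => by ring
  simp only [h2, Matrix.one_apply]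
  simp

/-- The defining relation `∂g = Γ g` of the Chern connection, with the inverse matrix cleared. -/
theorem dz_coeff [IsManifold 𝓘(ℂ, CSpace n) ω N]
    (he : e ∈ atlas (CSpace n) N) {z : CSpace n} (hz : z ∈ e.target) (k m : Fin n)
    (v : CSpace n) : dz (fun y => g.coeff e y k m) z v
      = ∑ i, g.chartSymbol e z v (coordVec k) i * g.coeff e z i m := by
  change dzLinear _ z v = _
  conv_lhs => rw [← sum_smul_coordVec v]
  rw [map_sum]
  have h1 : ∀ i, g.chartSymbol e z v (coordVec k) i = ∑ j, g.chernSymbol e i j k z * v j := by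
    intro i
    rw [chartSymbol_apply]
    simp [coordVec]
  simp only [h1, Finset.sum_mul]
  rw [Finset.sum_comm]
  refine Finset.sum_congr rfl fun j _ => ?_
  rw [map_smul, smul_eq_mul]
  change v j * dz _ z _ = _
  rw [← sum_chernSymbol_mul_coeff he hz, Finset.mul_sum]
  exact Finset.sum_congr rfl fun i _ => by ring

theorem chartSymbol_apply_eq_sum (z v a : CSpace n) (i : Fin n) :
    g.chartSymbol e z v a i = ∑ k, g.chartSymbol e z v (coordVec k) i * a k := by
  have h1 : ∀ k, g.chartSymbol e z v (coordVec k) i = ∑ j, g.chernSymbol e i j k z * v j := by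
    intro k
    rw [chartSymbol_apply]
    simp [coordVec]
  simp only [h1, chartSymbol_apply, Finset.sum_mul]
  rw [Finset.sum_comm]

theorem chartMetric_contDiffOn (he : e ∈ atlas (CSpace n) N) :
    ContDiffOn ℝ ∞ (g.chartMetric e) e.target := by
  refine contDiffOn_clm_apply.2 fun a => contDiffOn_clm_apply.2 fun b => fun z hz => ?_
  apply ContDiffAt.contDiffWithinAt
  simp only [chartMetric_apply, chartForm_expand]
  exact Complex.reCLM.contDiff.contDiffAt.comp z (ContDiffAt.sum fun k _ =>
    ContDiffAt.sum fun l _ => ((coeff_smooth he hz k l).mul contDiffAt_const).mul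
      contDiffAt_const)

theorem chartSymbol_contDiffOn [IsManifold 𝓘(ℂ, CSpace n) ω N] (he : e ∈ atlas (CSpace n) N) :
    ContDiffOn ℝ ∞ (g.chartSymbol e) e.target := by
  refine contDiffOn_clm_apply.2 fun a => contDiffOn_clm_apply.2 fun b => fun z hz => ?_
  apply ContDiffAt.contDiffWithinAt
  refine contDiffAt_piLp' 2 fun i => ?_
  simp only [chartSymbol_apply]
  exact (ContDiffAt.sum fun k _ =>
    ContDiffAt.sum fun l _ => ((chernSymbol_smooth he hz i k l).mul contDiffAt_const).mul
      contDiffAt_const)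

/-- Split `dg = ∂g + ∂̄g`. The relation `∂g = Γ g` differentiates the first argument, and its
conjugate, by Hermitian symmetry, the second. This holds for any Hermitian metric; the Kähler
condition enters only through the symmetry of `Γ`. -/
theorem fderiv_chartMetric [IsManifold 𝓘(ℂ, CSpace n) ω N] (he : e ∈ atlas (CSpace n) N)
    {y : CSpace n} (hy : y ∈ e.target) (v a b : CSpace n) :
    fderiv ℝ (g.chartMetric e) y v a b = g.chartMetric e y (g.chartSymbol e y v a) b
      + g.chartMetric e y a (g.chartSymbol e y v b) := by
  have hs := (differentiableAt_of_smooth ((chartMetric_contDiffOn (g := g) he).contDiffAt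
    (e.open_target.mem_nhds hy))).hasFDerivAt
  have h1 := ((hs.clm_apply (hasFDerivAt_const a y)).clm_apply (hasFDerivAt_const b y)).fderiv
  have h2 : fderiv ℝ (g.chartMetric e) y v a b
      = fderiv ℝ (fun t => g.chartMetric e t a b) y v := by rw [h1]; simp
  have hc := fun k l => (differentiableAt_of_smooth (coeff_smooth (g := g) he hy k l)).hasFDerivAt
  have h3 : HasFDerivAt (fun t => (∑ k, ∑ l, g.coeff e t k l * a k * star (b l)).re) _ y :=
    Complex.reCLM.hasFDerivAt.comp y (HasFDerivAt.fun_sum (u := Finset.univ) fun k _ =>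
      HasFDerivAt.fun_sum (u := Finset.univ) fun l _ =>
        ((hc k l).mul_const (a k)).mul_const (star (b l)))
  rw [h2]
  simp only [chartMetric_apply, chartForm_expand]
  rw [h3.fderiv, ← Complex.add_re]
  have hd : ∀ k l, fderiv ℝ (fun y => g.coeff e y k l) y v
      = ∑ i, g.chartSymbol e y v (coordVec k) i * g.coeff e y i l
        + ∑ i, star (g.chartSymbol e y v (coordVec l) i) * g.coeff e y k i := by
    intro k l
    rw [fderiv_eq_dz_add_dzbar, dzbar_eq_star]
    simp only [coeff_star]
    rw [dz_coeff he hy, dz_coeff he hy, star_sum]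
    simp only [star_mul', coeff_star]
  simp only [ContinuousLinearMap.comp_apply, sum_apply, smul_apply, Complex.reCLM_apply, hd]
  congr 1
  simp only [chartSymbol_apply_eq_sum (g := g) _ _ a, chartSymbol_apply_eq_sum (g := g) _ _ b]
  simp only [smul_eq_mul, mul_add, Finset.sum_add_distrib, Finset.mul_sum, Finset.sum_mul, star_sum]
  congr 1
  · rw [Finset.sum_comm]
    conv_rhs => rw [Finset.sum_comm]
    refine Finset.sum_congr rfl fun l _ => ?_
    rw [Finset.sum_comm]
    exact Finset.sum_congr rfl fun i _ => Finset.sum_congr rfl fun k _ => by ring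
  · refine Finset.sum_congr rfl fun k _ => ?_
    rw [Finset.sum_comm]
    refine Finset.sum_congr rfl fun i _ => Finset.sum_congr rfl fun l _ => ?_
    rw [star_mul']
    ring

/-- The Chern connection of a Kähler metric is the Levi-Civita connection of the underlying
Riemannian metric. -/
theorem isLeviCivitaOn [IsManifold 𝓘(ℂ, CSpace n) ω N] (hK : g.IsKahler)
    (he : e ∈ atlas (CSpace n) N) :
    IsLeviCivitaOn (g.chartMetric e) (g.chartSymbol e) e.target where
  isOpen := e.open_target
  smooth_metric y hy := (chartMetric_contDiffOn he).contDiffAt (e.open_target.mem_nhds hy)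
  smooth_symbol y hy := (chartSymbol_contDiffOn he).contDiffAt (e.open_target.mem_nhds hy)
  metric_symm y _ a b := by
    rw [chartMetric_apply, chartMetric_apply, chartForm, ← g.conj_symm]
    exact Complex.conj_re _
  metric_nonneg y hy a := by
    by_cases ha : a = 0
    · simp [ha]
    · exact (chartMetric_pos he hy ha).le
  symbol_symm y hy a b := by
    ext i
    rw [chartSymbol_apply, chartSymbol_apply, Finset.sum_comm]
    refine Finset.sum_congr rfl fun k _ => Finset.sum_congr rfl fun j _ => ?_
    have : g.chernSymbol e i j k y = g.chernSymbol e i k j y := by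
      simp only [chernSymbol]
      exact Finset.sum_congr rfl fun l _ => by rw [hK e he y hy j k l]
    rw [this]; ring
  compat y hy := fderiv_chartMetric he hy

/-- The real coordinate vectors as a basis. -/
def realCoordBasis (n : ℕ) : Module.Basis (Fin n ⊕ Fin n) ℝ (CSpace n) :=
  Module.Basis.ofEquivFun
    { toFun := fun a => Sum.elim (fun k => (a k).re) (fun k => (a k).im)
      invFun := fun X => WithLp.toLp 2 fun k => ⟨X (Sum.inl k), X (Sum.inr k)⟩
      map_add' := fun a b => by ext (k | k) <;> simp
      map_smul' := fun r a => by ext (k | k) <;> simp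
      left_inv := fun a => by ext k; simp
      right_inv := fun X => by ext (k | k) <;> simp }

theorem coe_realCoordBasis : ⇑(realCoordBasis n) = realCoordVec := by
  funext i
  rw [realCoordBasis, Module.Basis.coe_ofEquivFun, LinearEquiv.symm_apply_eq]
  funext k
  rcases i with i | i <;> rcases k with k | k <;> by_cases h : k = i <;>
    simp [realCoordVec, coordVec, h]

/-- Non-positive sectional curvature in terms of the curvature operator. -/
theorem curvOp_nonneg [IsManifold 𝓘(ℂ, CSpace n) ω N] (hK : g.IsKahler)
    (hcurv : g.NonposSectionalCurvature) (he : e ∈ atlas (CSpace n) N) {y : CSpace n}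
    (hy : y ∈ e.target) (X Y : CSpace n) :
    0 ≤ g.chartMetric e y (curvOp (g.chartSymbol e) y X Y X) Y :=
  (isLeviCivitaOn hK he).curvOp_nonneg (b := realCoordBasis n) (g := g.realCoeff e)
    (fun _ hz _ ha => chartMetric_pos he hz ha)
    (fun _ _ _ _ => by rw [coe_realCoordBasis]; rfl) hy
    (fun X Y h => by rw [coe_realCoordBasis]; exact hcurv e he y hy X Y h) X Y

end HermitianMetric

end Hermitian

/-! ### Underlying real manifolds and the differential of `f` in charts -/

section RealManifold

variable {m : ℕ} {M : Type*} [TopologicalSpace M] [ChartedSpace (CSpace m) M]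

theorem isManifold_real [IsManifold 𝓘(ℂ, CSpace m) ω M] : IsManifold 𝓘(ℝ, CSpace m) ∞ M := by
  refine isManifold_of_contDiffOn _ _ _ fun e e' he he' => ?_
  have h := StructureGroupoid.compatible (contDiffGroupoid ω 𝓘(ℂ, CSpace m)) he he'
  have h1 := (mem_groupoid_of_pregroupoid.1 h).1
  exact (ContDiffOn.of_le (ContDiffOn.restrict_scalars ℝ h1) le_top)

theorem hasMFDerivAt_real {n : ℕ} {N : Type*} [TopologicalSpace N] [ChartedSpace (CSpace n) N]
    {f : M → N} {x : M} (hf : MDifferentiableAt 𝓘(ℂ, CSpace m) 𝓘(ℂ, CSpace n) f x) :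
    HasMFDerivAt 𝓘(ℝ, CSpace m) 𝓘(ℝ, CSpace n) f x
      ((mfderiv 𝓘(ℂ, CSpace m) 𝓘(ℂ, CSpace n) f x :
        CSpace m →L[ℂ] CSpace n).restrictScalars ℝ) :=
  ⟨hf.hasMFDerivAt.1, hf.hasMFDerivAt.2.restrictScalars ℝ⟩

end RealManifold

section ChartRep

variable {m n : ℕ} {M N : Type*} [TopologicalSpace M] [TopologicalSpace N]

/-- The expression of a map in charts of the source and the target. -/
def chartRep (f : M → N) (φ : OpenPartialHomeomorph M (CSpace m))
    (ψ : OpenPartialHomeomorph N (CSpace n)) (z : CSpace m) : CSpace n :=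
  ψ (f (φ.symm z))

/-- The domain of `chartRep`. -/
def chartDom (f : M → N) (φ : OpenPartialHomeomorph M (CSpace m))
    (ψ : OpenPartialHomeomorph N (CSpace n)) : Set (CSpace m) :=
  φ.target ∩ (fun z => f (φ.symm z)) ⁻¹' ψ.source

variable {f : M → N} {φ : OpenPartialHomeomorph M (CSpace m)}
  {ψ : OpenPartialHomeomorph N (CSpace n)}

theorem isOpen_chartDom (hf : Continuous f) : IsOpen (chartDom f φ ψ) :=
  (hf.comp_continuousOn φ.continuousOn_symm).isOpen_inter_preimage φ.open_target ψ.open_source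

variable [ChartedSpace (CSpace m) M] [ChartedSpace (CSpace n) N]

/-- All tangent spaces are definitionally `CSpace n`, so the same vectors make sense at both base
points. -/
theorem form_congr (g : HermitianMetric n N) {p q : N} (h : p = q) (u v : CSpace n) :
    g.form p u v = g.form q u v := by subst h; rfl

/-- The energy of a map in the complex direction `v`. -/
def energy (g : HermitianMetric n N) (f : M → N) (p : M)
    (v : TangentSpace 𝓘(ℂ, CSpace m) p) : ℝ :=
  (g.form (f p) (mfderiv 𝓘(ℝ, CSpace m) 𝓘(ℝ, CSpace n) f p v)
    (mfderiv 𝓘(ℝ, CSpace m) 𝓘(ℝ, CSpace n) f p v)).re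
  + (g.form (f p) (mfderiv 𝓘(ℝ, CSpace m) 𝓘(ℝ, CSpace n) f p (Complex.I • v))
    (mfderiv 𝓘(ℝ, CSpace m) 𝓘(ℝ, CSpace n) f p (Complex.I • v))).re

variable [IsManifold 𝓘(ℂ, CSpace m) ω M] [IsManifold 𝓘(ℂ, CSpace n) ω N]

theorem chartRep_smooth (hf : ContMDiff 𝓘(ℝ, CSpace m) 𝓘(ℝ, CSpace n) ∞ f)
    (hφ : φ ∈ atlas (CSpace m) M) (hψ : ψ ∈ atlas (CSpace n) N) {z : CSpace m}
    (hz : z ∈ chartDom f φ ψ) : ContDiffAt ℝ ∞ (chartRep f φ ψ) z := by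
  have := isManifold_real (m := m) (M := M)
  have := isManifold_real (m := n) (M := N)
  rw [← contMDiffAt_iff_contDiffAt]
  have h1 : ContMDiffAt 𝓘(ℝ, CSpace m) 𝓘(ℝ, CSpace m) ∞ φ.symm z :=
    (contMDiffOn_symm_of_mem_maximalAtlas (IsManifold.subset_maximalAtlas hφ)).contMDiffAt
      (φ.open_target.mem_nhds hz.1)
  have h2 : ContMDiffAt 𝓘(ℝ, CSpace n) 𝓘(ℝ, CSpace n) ∞ ψ (f (φ.symm z)) :=
    (contMDiffOn_of_mem_maximalAtlas (IsManifold.subset_maximalAtlas hψ)).contMDiffAt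
      (ψ.open_source.mem_nhds hz.2)
  exact h2.comp z (hf.contMDiffAt.comp z h1)

/-- The real differential in charts. -/
theorem mfderiv_chartVec (hf : ContMDiff 𝓘(ℝ, CSpace m) 𝓘(ℝ, CSpace n) ∞ f)
    (hφ : φ ∈ atlas (CSpace m) M) (hψ : ψ ∈ atlas (CSpace n) N) {z : CSpace m}
    (hz : z ∈ chartDom f φ ψ) (v : CSpace m) :
    (mfderiv 𝓘(ℝ, CSpace m) 𝓘(ℝ, CSpace n) f (φ.symm z) (chartVec φ z v) : CSpace n)
      = chartVec ψ (chartRep f φ ψ z) (fderiv ℝ (chartRep f φ ψ) z v) := by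
  have h1M : IsManifold 𝓘(ℂ, CSpace m) 1 M := IsManifold.of_le (n := ω) le_top
  have h1N : IsManifold 𝓘(ℂ, CSpace n) 1 N := IsManifold.of_le (n := ω) le_top
  have a1 := hasMFDerivAt_real (mdifferentiableAt_atlas_symm (I := 𝓘(ℂ, CSpace m)) hφ hz.1)
  have a2 := ((hf (φ.symm z)).mdifferentiableAt (by simp)).hasMFDerivAt
  have a3 := HasMFDerivAt.comp z a2 a1
  have ht : chartRep f φ ψ z ∈ ψ.target := ψ.map_source hz.2
  have b1 := hasMFDerivAt_real (mdifferentiableAt_atlas_symm (I := 𝓘(ℂ, CSpace n)) hψ ht)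
  have b2 := (differentiableAt_of_smooth (chartRep_smooth hf hφ hψ hz)).hasFDerivAt.hasMFDerivAt
  have b3 := HasMFDerivAt.comp z b1 b2
  have hev : f ∘ φ.symm =ᶠ[nhds z] ψ.symm ∘ chartRep f φ ψ := by
    filter_upwards [(isOpen_chartDom hf.continuous).mem_nhds hz] with t ht
    exact (ψ.left_inv ht.2).symm
  have hu := hasMFDerivAt_unique a3 (b3.congr_of_eventuallyEq hev)
  exact DFunLike.congr_fun hu v

theorem energy_chartVec (g : HermitianMetric n N)
    (hf : ContMDiff 𝓘(ℝ, CSpace m) 𝓘(ℝ, CSpace n) ∞ f)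
    (hφ : φ ∈ atlas (CSpace m) M) (hψ : ψ ∈ atlas (CSpace n) N) {z : CSpace m}
    (hz : z ∈ chartDom f φ ψ) (v : CSpace m) :
    energy g f (φ.symm z) (chartVec φ z v)
      = energyForm (g.chartMetric ψ) (chartRep f φ ψ) z v := by
  have hq : f (φ.symm z) = ψ.symm (chartRep f φ ψ z) := (ψ.left_inv hz.2).symm
  have key : ∀ w : CSpace m, (g.form (f (φ.symm z))
      (mfderiv 𝓘(ℝ, CSpace m) 𝓘(ℝ, CSpace n) f (φ.symm z) (chartVec φ z w))
      (mfderiv 𝓘(ℝ, CSpace m) 𝓘(ℝ, CSpace n) f (φ.symm z) (chartVec φ z w))).re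
      = g.chartMetric ψ (chartRep f φ ψ z) (fderiv ℝ (chartRep f φ ψ) z w)
        (fderiv ℝ (chartRep f φ ψ) z w) := by
    intro w
    have h1 := mfderiv_chartVec hf hφ hψ hz w
    refine congrArg Complex.re ((form_congr g hq _ _).trans ?_)
    rw [h1]
    rfl
  rw [energy, ← chartVec_smul, key, key, energyForm]

end ChartRep

/-! ### From the complex pluri-harmonic equation to its real form -/

section Pluriharmonic

variable {m n : ℕ} {M N : Type*} [TopologicalSpace M] [ChartedSpace (CSpace m) M]
  [IsManifold 𝓘(ℂ, CSpace m) ω M]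
  [TopologicalSpace N] [ChartedSpace (CSpace n) N] [IsManifold 𝓘(ℂ, CSpace n) ω N]
  {g : HermitianMetric n N} {f : M → N} {φ : OpenPartialHomeomorph M (CSpace m)}
  {ψ : OpenPartialHomeomorph N (CSpace n)}

/-- The second fundamental form of `f` on `(∂_u, ∂̄_v)`, in charts. -/
def mixedHessian (g : HermitianMetric n N) (f : M → N) (φ : OpenPartialHomeomorph M (CSpace m))
    (ψ : OpenPartialHomeomorph N (CSpace n)) (i : Fin n) (z u v : CSpace m) : ℂ :=
  dz (fun y => dzbar (localComp f φ ψ i) y v) z u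
    + ∑ j, ∑ k, g.chernSymbol ψ i j k (chartRep f φ ψ z)
      * dz (localComp f φ ψ j) z u * dzbar (localComp f φ ψ k) z v

theorem dzbar_expand (c : CSpace m → ℂ) (x v : CSpace m) :
    dzbar c x v = ∑ b, star (v b) * dzbar c x (coordVec b) := by
  simp only [dzbar_eq_star]
  change star (dzLinear _ x v) = _
  conv_lhs => rw [← sum_smul_coordVec v]
  simp only [map_sum, map_smul, star_sum, smul_eq_mul, star_mul']
  rfl

theorem dz_expand (c : CSpace m → ℂ) (x v : CSpace m) :
    dz c x v = ∑ a, v a * dz c x (coordVec a) := by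
  change dzLinear _ x v = _
  conv_lhs => rw [← sum_smul_coordVec v]
  simp only [map_sum, map_smul, smul_eq_mul]
  rfl

theorem localComp_smooth (hf : ContMDiff 𝓘(ℝ, CSpace m) 𝓘(ℝ, CSpace n) ∞ f)
    (hφ : φ ∈ atlas (CSpace m) M) (hψ : ψ ∈ atlas (CSpace n) N) {z : CSpace m}
    (hz : z ∈ chartDom f φ ψ) (i : Fin n) : ContDiffAt ℝ ∞ (localComp f φ ψ i) z :=
  (EuclideanSpace.proj (𝕜 := ℂ) i : CSpace n →L[ℂ] ℂ).restrictScalars ℝ |>.contDiff.contDiffAt.comp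
    z (chartRep_smooth hf hφ hψ hz)

theorem dzbar_smooth {V : Type*} [NormedAddCommGroup V] [NormedSpace ℂ V] {c : V → ℂ} {x : V}
    (hc : ContDiffAt ℝ ∞ c x) (v : V) : ContDiffAt ℝ ∞ (fun y => dzbar c y v) x :=
  contDiffAt_const.mul ((contDiffAt_fderiv_apply hc v).add
    (contDiffAt_const.mul (contDiffAt_fderiv_apply hc _)))

theorem dz_dzbar_expand {c : CSpace m → ℂ} {z : CSpace m} (hc : ContDiffAt ℝ ∞ c z)
    (u v : CSpace m) : dz (fun y => dzbar c y v) z u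
      = ∑ a, ∑ b, u a * star (v b) * dz (fun y => dzbar c y (coordVec b)) z (coordVec a) := by
  have h1 : ∀ w, dz (fun y => dzbar c y v) z w
      = ∑ b, star (v b) * dz (fun y => dzbar c y (coordVec b)) z w := by
    intro w
    have hd : HasFDerivAt (fun y => dzbar c y v) _ z :=
      (HasFDerivAt.fun_sum (u := Finset.univ) fun b _ =>
        (differentiableAt_of_smooth (dzbar_smooth hc (coordVec b))).hasFDerivAt.const_mul
          (star (v b))).congr_of_eventuallyEq (Filter.Eventually.of_forall fun y =>
            dzbar_expand c y v)
    rw [dz, hd.fderiv]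
    simp only [sum_apply, smul_apply, smul_eq_mul, dz, Finset.mul_sum, ← Finset.sum_sub_distrib]
    exact Finset.sum_congr rfl fun b _ => by ring
  rw [dz_expand]
  refine Finset.sum_congr rfl fun a _ => ?_
  rw [h1, Finset.mul_sum]
  exact Finset.sum_congr rfl fun b _ => by ring

theorem mixedHessian_eq_zero (hf : IsPluriharmonic (m := m) g f)
    (hφ : φ ∈ atlas (CSpace m) M) (hψ : ψ ∈ atlas (CSpace n) N) {z : CSpace m}
    (hz : z ∈ chartDom f φ ψ) (i : Fin n) (u v : CSpace m) :
    mixedHessian g f φ ψ i z u v = 0 := by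
  have key : mixedHessian g f φ ψ i z u v
      = ∑ a, ∑ b, u a * star (v b) * mixedHessian g f φ ψ i z (coordVec a) (coordVec b) := by
    simp only [mixedHessian, mul_add, Finset.sum_add_distrib]
    rw [dz_dzbar_expand (localComp_smooth hf.smooth hφ hψ hz i)]
    congr 1
    have e : ∀ j k, g.chernSymbol ψ i j k (chartRep f φ ψ z) * dz (localComp f φ ψ j) z u
        * dzbar (localComp f φ ψ k) z v = ∑ a, ∑ b, u a * star (v b) *
        (g.chernSymbol ψ i j k (chartRep f φ ψ z) * dz (localComp f φ ψ j) z (coordVec a)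
        * dzbar (localComp f φ ψ k) z (coordVec b)) := by
      intro j k
      rw [dz_expand, dzbar_expand, mul_assoc, Finset.sum_mul_sum, Finset.mul_sum]
      refine Finset.sum_congr rfl fun a _ => ?_
      rw [Finset.mul_sum]
      exact Finset.sum_congr rfl fun b _ => by ring
    simp only [e, Finset.mul_sum]
    rw [Finset.sum_congr rfl fun j _ => Finset.sum_comm, Finset.sum_comm]
    refine Finset.sum_congr rfl fun a _ => ?_
    rw [Finset.sum_congr rfl fun j _ => Finset.sum_comm, Finset.sum_comm]
  rw [key]
  refine Finset.sum_eq_zero fun a _ => Finset.sum_eq_zero fun b _ => ?_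
  have : mixedHessian g f φ ψ i z (coordVec a) (coordVec b) = 0 :=
    hf.eq_zero φ hφ ψ hψ z hz.1 hz.2 a b i
  rw [this, mul_zero]

theorem fderiv_localComp (hf : ContMDiff 𝓘(ℝ, CSpace m) 𝓘(ℝ, CSpace n) ∞ f)
    (hφ : φ ∈ atlas (CSpace m) M) (hψ : ψ ∈ atlas (CSpace n) N) {z : CSpace m}
    (hz : z ∈ chartDom f φ ψ) (i : Fin n) (v : CSpace m) :
    fderiv ℝ (localComp f φ ψ i) z v = fderiv ℝ (chartRep f φ ψ) z v i := by
  have h := (((EuclideanSpace.proj (𝕜 := ℂ) i : CSpace n →L[ℂ] ℂ).restrictScalars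
    ℝ).hasFDerivAt.comp z
    (differentiableAt_of_smooth (chartRep_smooth hf hφ hψ hz)).hasFDerivAt).fderiv
  exact DFunLike.congr_fun h v

/-- Expansion of `∇dF(u - √-1 Ju, v + √-1 Jv)`. The components of `∇dF` are themselves complex, so
the last bracket is not an imaginary part and cannot be separated off directly. -/
theorem mixedHessian_eq (hf : ContMDiff 𝓘(ℝ, CSpace m) 𝓘(ℝ, CSpace n) ∞ f)
    (hφ : φ ∈ atlas (CSpace m) M) (hψ : ψ ∈ atlas (CSpace n) N) {z : CSpace m}
    (hz : z ∈ chartDom f φ ψ) (i : Fin n) (u v : CSpace m) :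
    4 * mixedHessian g f φ ψ i z u v
      = covDeriv (g.chartSymbol ψ) (chartRep f φ ψ) u
          (fun y => fderiv ℝ (chartRep f φ ψ) y v) z i
        + covDeriv (g.chartSymbol ψ) (chartRep f φ ψ) (Complex.I • u)
          (fun y => fderiv ℝ (chartRep f φ ψ) y (Complex.I • v)) z i
        + Complex.I * (covDeriv (g.chartSymbol ψ) (chartRep f φ ψ) u
          (fun y => fderiv ℝ (chartRep f φ ψ) y (Complex.I • v)) z i
        - covDeriv (g.chartSymbol ψ) (chartRep f φ ψ) (Complex.I • u)
          (fun y => fderiv ℝ (chartRep f φ ψ) y v) z i) := by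
  have hc := localComp_smooth hf hφ hψ hz i
  have hD : ∀ u v, fderiv ℝ (fun y => fderiv ℝ (chartRep f φ ψ) y v) z u i
      = fderiv ℝ (fun y => fderiv ℝ (localComp f φ ψ i) y v) z u := by
    intro u v
    have hev : (fun y => fderiv ℝ (localComp f φ ψ i) y v) =ᶠ[nhds z]
        fun y => fderiv ℝ (chartRep f φ ψ) y v i := by
      filter_upwards [(isOpen_chartDom hf.continuous).mem_nhds hz] with t ht
      exact fderiv_localComp hf hφ hψ ht i v
    rw [hev.fderiv_eq]
    have h := (((EuclideanSpace.proj (𝕜 := ℂ) i : CSpace n →L[ℂ] ℂ).restrictScalars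
      ℝ).hasFDerivAt.comp z (differentiableAt_of_smooth (contDiffAt_fderiv_apply
        (chartRep_smooth hf hφ hψ hz) v)).hasFDerivAt).fderiv
    exact (DFunLike.congr_fun h u).symm
  have hS : ∀ u v, covDeriv (g.chartSymbol ψ) (chartRep f φ ψ) u
      (fun y => fderiv ℝ (chartRep f φ ψ) y v) z i
      = fderiv ℝ (fun y => fderiv ℝ (localComp f φ ψ i) y v) z u
        + ∑ j, ∑ k, g.chernSymbol ψ i j k (chartRep f φ ψ z)
          * fderiv ℝ (localComp f φ ψ j) z u * fderiv ℝ (localComp f φ ψ k) z v := by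
    intro u v
    rw [covDeriv, PiLp.add_apply, hD, HermitianMetric.chartSymbol_apply]
    simp only [fderiv_localComp hf hφ hψ hz]
  have hB : ∀ w, fderiv ℝ (fun y => dzbar (localComp f φ ψ i) y v) z w
      = (1 / 2) * (fderiv ℝ (fun y => fderiv ℝ (localComp f φ ψ i) y v) z w
        + Complex.I * fderiv ℝ (fun y => fderiv ℝ (localComp f φ ψ i) y (Complex.I • v)) z w) := by
    intro w
    have h : HasFDerivAt (fun y => dzbar (localComp f φ ψ i) y v) _ z :=
      ((differentiableAt_of_smooth (contDiffAt_fderiv_apply hc v)).hasFDerivAt.add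
        ((differentiableAt_of_smooth (contDiffAt_fderiv_apply hc
          (Complex.I • v))).hasFDerivAt.const_mul Complex.I)).const_mul (1 / 2)
    rw [h.fderiv]
    simp
    ring
  rw [mixedHessian, hS, hS, hS, hS]
  have hsum : 4 * ∑ j, ∑ k, g.chernSymbol ψ i j k (chartRep f φ ψ z)
      * dz (localComp f φ ψ j) z u * dzbar (localComp f φ ψ k) z v
      = ∑ j, ∑ k, g.chernSymbol ψ i j k (chartRep f φ ψ z)
          * fderiv ℝ (localComp f φ ψ j) z u * fderiv ℝ (localComp f φ ψ k) z v
        + ∑ j, ∑ k, g.chernSymbol ψ i j k (chartRep f φ ψ z)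
          * fderiv ℝ (localComp f φ ψ j) z (Complex.I • u)
          * fderiv ℝ (localComp f φ ψ k) z (Complex.I • v)
        + Complex.I * (∑ j, ∑ k, g.chernSymbol ψ i j k (chartRep f φ ψ z)
          * fderiv ℝ (localComp f φ ψ j) z u
          * fderiv ℝ (localComp f φ ψ k) z (Complex.I • v)
        - ∑ j, ∑ k, g.chernSymbol ψ i j k (chartRep f φ ψ z)
          * fderiv ℝ (localComp f φ ψ j) z (Complex.I • u)
          * fderiv ℝ (localComp f φ ψ k) z v) := by
    simp only [Finset.mul_sum, ← Finset.sum_add_distrib, ← Finset.sum_sub_distrib]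
    refine Finset.sum_congr rfl fun j _ => Finset.sum_congr rfl fun k _ => ?_
    simp only [dz, dzbar]
    linear_combination (-g.chernSymbol ψ i j k (chartRep f φ ψ z)
      * fderiv ℝ (localComp f φ ψ j) z (Complex.I • u)
      * fderiv ℝ (localComp f φ ψ k) z (Complex.I • v)) * Complex.I_sq
  rw [mul_add, hsum]
  simp only [dz, hB]
  linear_combination (-fderiv ℝ (fun y => fderiv ℝ (localComp f φ ψ i) y (Complex.I • v)) z
    (Complex.I • u)) * Complex.I_sq

theorem IsPluriharmonic.isRealPluriharmonicOn (hf : IsPluriharmonic (m := m) g f)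
    (hK : g.IsKahler) (hφ : φ ∈ atlas (CSpace m) M) (hψ : ψ ∈ atlas (CSpace n) N) :
    IsRealPluriharmonicOn (g.chartSymbol ψ) ψ.target (chartRep f φ ψ) (chartDom f φ ψ) where
  isOpen := isOpen_chartDom hf.smooth.continuous
  smooth z hz := chartRep_smooth hf.smooth hφ hψ hz
  mapsTo z hz := ψ.map_source hz.2
  eq_zero z hz u v := by
    have hx : chartRep f φ ψ z ∈ ψ.target := ψ.map_source hz.2
    have hs : ∀ u v, covDeriv (g.chartSymbol ψ) (chartRep f φ ψ) u
        (fun y => fderiv ℝ (chartRep f φ ψ) y v) z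
        = covDeriv (g.chartSymbol ψ) (chartRep f φ ψ) v
        (fun y => fderiv ℝ (chartRep f φ ψ) y u) z := by
      intro u v
      rw [covDeriv, covDeriv, fderiv_apply_comm (chartRep_smooth hf.smooth hφ hψ hz),
        (HermitianMetric.isLeviCivitaOn hK hψ).symbol_symm _ hx]
    ext i
    have h1 := mixedHessian_eq (g := g) hf.smooth hφ hψ hz i u v
    -- Exchanging `u` and `v` reverses the sign of the bracket multiplied by `√-1`, since `∇dF` is
    -- symmetric for a torsion-free connection; the sum of the two equations is the real one.
    have h2 := mixedHessian_eq (g := g) hf.smooth hφ hψ hz i v u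
    rw [mixedHessian_eq_zero hf hφ hψ hz] at h1 h2
    rw [hs v u, hs (Complex.I • v) (Complex.I • u), hs v (Complex.I • u),
      hs (Complex.I • v) u] at h2
    rw [PiLp.add_apply, PiLp.zero_apply]
    linear_combination (-1 / 2) * h1 + (-1 / 2) * h2

end Pluriharmonic

/-! ### Norms on tautological lines and affine charts of projective space -/

section TautNorm

variable {m : ℕ} {M : Type*} [TopologicalSpace M] [ChartedSpace (CSpace m) M]

theorem normSqOf_eq (H : (x : ProjTangent m M) → x.2.submodule → ℝ) (p : M)
    {v : TangentSpace 𝓘(ℂ, CSpace m) p} (hv : v ≠ 0)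
    (ℓ : ℙ ℂ (TangentSpace 𝓘(ℂ, CSpace m) p)) (hℓ : v ∈ ℓ.submodule) :
    normSqOf H p v = H ⟨p, ℓ⟩ ⟨v, hℓ⟩ := by
  have hl : Projectivization.mk ℂ v hv = ℓ := by
    induction ℓ using Projectivization.ind with
    | h w hw =>
      rw [Projectivization.submodule_mk, Submodule.mem_span_singleton] at hℓ
      obtain ⟨c, rfl⟩ := hℓ
      exact (Projectivization.mk_eq_mk_iff' ℂ _ _ _ _).2 ⟨c, rfl⟩
  subst hl
  rw [normSqOf, dif_neg hv]

theorem TautMetric.normSqOf_pos (H : TautMetric (m := m) M) (p : M)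
    {v : TangentSpace 𝓘(ℂ, CSpace m) p} (hv : v ≠ 0) : 0 < normSqOf H.normSq p v := by
  rw [normSqOf, dif_neg hv]
  exact H.normSq_pos _ _ fun h => hv (congrArg Subtype.val h)

theorem TautMetric.normSqOf_smul (H : TautMetric (m := m) M) (p : M)
    {v : TangentSpace 𝓘(ℂ, CSpace m) p} (hv : v ≠ 0) {c : ℂ} (hc : c ≠ 0) :
    normSqOf H.normSq p (c • v) = ‖c‖ ^ 2 * normSqOf H.normSq p v := by
  have h1 : v ∈ (Projectivization.mk ℂ v hv).submodule := by
    rw [Projectivization.submodule_mk]; exact Submodule.mem_span_singleton_self v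
  rw [normSqOf_eq H.normSq p (smul_ne_zero hc hv) (Projectivization.mk ℂ v hv)
    (Submodule.smul_mem _ c h1), normSqOf_eq H.normSq p hv (Projectivization.mk ℂ v hv) h1,
    ← H.normSq_smul]
  rfl

end TautNorm

section AffineChart

variable {m : ℕ}

/-- The linear part of `affineVec j`. -/
def affineLin (j : Fin m) : ({i : Fin m // i ≠ j} → ℂ) →L[ℂ] CSpace m :=
  LinearMap.toContinuousLinearMap
    { toFun := fun w => WithLp.toLp 2 fun i => if h : i = j then 0 else w ⟨i, h⟩
      map_add' := fun u v => by
        ext i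
        by_cases h : i = j <;> simp [h]
      map_smul' := fun c v => by
        ext i
        by_cases h : i = j <;> simp [h] }

theorem affineVec_eq (j : Fin m) (w : {i : Fin m // i ≠ j} → ℂ) :
    affineVec j w = affineVec j 0 + affineLin j w := by
  ext i
  change (if h : i = j then (1 : ℂ) else w ⟨i, h⟩)
    = (if h : i = j then 1 else 0) + (if h : i = j then 0 else w ⟨i, h⟩)
  split_ifs
  · exact (add_zero _).symm
  · exact (zero_add _).symm

theorem affineVec_ne_zero (j : Fin m) (w : {i : Fin m // i ≠ j} → ℂ) : affineVec j w ≠ 0 := by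
  intro h
  have := congrArg (fun v : CSpace m => v j) h
  simp [affineVec] at this

theorem contDiff_affineVec (j : Fin m) :
    ContDiff ℝ ∞ (fun q : CSpace m × ({i : Fin m // i ≠ j} → ℂ) => affineVec j q.2) := by
  rw [funext fun q : CSpace m × ({i : Fin m // i ≠ j} → ℂ) => affineVec_eq j q.2]
  exact contDiff_const.add (((affineLin j).restrictScalars ℝ).contDiff.comp contDiff_snd)

theorem hasFDerivAt_affineVec (j : Fin m) (q : CSpace m × ({i : Fin m // i ≠ j} → ℂ)) :
    HasFDerivAt (fun q : CSpace m × ({i : Fin m // i ≠ j} → ℂ) => affineVec j q.2)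
      (((affineLin j).comp (ContinuousLinearMap.snd ℂ (CSpace m) _)).restrictScalars ℝ) q := by
  have h : (fun q : CSpace m × ({i : Fin m // i ≠ j} → ℂ) => affineVec j q.2)
      = fun q => affineVec j 0 + ((affineLin j).comp
        (ContinuousLinearMap.snd ℂ (CSpace m) _)).restrictScalars ℝ q := by
    funext q; exact affineVec_eq j q.2
  rw [h]
  exact (ContinuousLinearMap.hasFDerivAt _).const_add _

/-- Every nonzero vector is a multiple of some `affineVec j w` with `w` in the unit polydisc. -/
theorem exists_smul_affineVec {v : CSpace m} (hv : v ≠ 0) :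
    ∃ (j : Fin m) (w : {i : Fin m // i ≠ j} → ℂ) (c : ℂ), ‖w‖ ≤ 1 ∧ c ≠ 0
      ∧ v = c • affineVec j w := by
  have hne : ∃ i, v i ≠ 0 := by
    by_contra! h
    exact hv (by ext i; simpa using h i)
  obtain ⟨i₀, hi₀⟩ := hne
  -- Dividing by a coordinate of largest modulus puts all affine coordinates in the closed unit
  -- disc.
  obtain ⟨j, -, hj⟩ := Finset.exists_max_image Finset.univ (fun i => ‖v i‖) ⟨i₀, Finset.mem_univ _⟩
  have hj0 : v j ≠ 0 := by
    have := hj i₀ (Finset.mem_univ _)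
    have h2 := norm_pos_iff.2 hi₀
    exact norm_pos_iff.1 (h2.trans_le this)
  refine ⟨j, fun i => v i / v j, v j, ?_, hj0, ?_⟩
  · rw [pi_norm_le_iff_of_nonneg zero_le_one]
    intro i
    rw [norm_div]
    exact div_le_one_of_le₀ (hj i (Finset.mem_univ _)) (norm_nonneg _)
  · ext i
    by_cases h : i = j
    · simp [h, affineVec]
    · simp only [affineVec, PiLp.smul_apply, h, dite_false, smul_eq_mul]
      field_simp

end AffineChart

/-! ### Compactness of the projective bundle -/

section Maximum

variable {m : ℕ} {M : Type*} [TopologicalSpace M] [ChartedSpace (CSpace m) M]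
  [IsManifold 𝓘(ℂ, CSpace m) ω M]

/-- A continuous function on `ℙ(T_M)`, given as a homogeneous function of tangent vectors, attains
its maximum. -/
theorem exists_max_projTangent [CompactSpace M] [Nonempty M] [Nonempty (Fin m)]
    (Y : (p : M) → TangentSpace 𝓘(ℂ, CSpace m) p → ℝ)
    (hcont : ∀ e ∈ atlas (CSpace m) M, ∀ j : Fin m, ContinuousOn
      (fun q : CSpace m × ({i : Fin m // i ≠ j} → ℂ) =>
        Y (e.symm q.1) (chartVec e q.1 (affineVec j q.2))) (e.target ×ˢ Set.univ))
    (hhom : ∀ e ∈ atlas (CSpace m) M, ∀ z ∈ e.target, ∀ (c : ℂ) (v : CSpace m), c ≠ 0 → v ≠ 0 →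
      Y (e.symm z) (chartVec e z (c • v)) = Y (e.symm z) (chartVec e z v)) :
    ∃ e ∈ atlas (CSpace m) M, ∃ (j : Fin m), ∃ z ∈ e.target, ∃ w : {i : Fin m // i ≠ j} → ℂ,
      ∀ (p : M) (v : TangentSpace 𝓘(ℂ, CSpace m) p), v ≠ 0 →
        Y p v ≤ Y (e.symm z) (chartVec e z (affineVec j w)) := by
  -- Requiring the bound to be an attained value makes the induction over a compact set yield a
  -- maximum, not just an upper bound.
  let S : Set ℝ := {r | ∃ e ∈ atlas (CSpace m) M, ∃ (j : Fin m), ∃ z ∈ e.target,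
    ∃ w : {i : Fin m // i ≠ j} → ℂ, Y (e.symm z) (chartVec e z (affineVec j w)) = r}
  suffices h : ∃ r ∈ S, ∀ p ∈ (Set.univ : Set M), ∀ v : TangentSpace 𝓘(ℂ, CSpace m) p, v ≠ 0 →
      Y p v ≤ r by
    obtain ⟨r, ⟨e, he, j, z, hz, w, rfl⟩, hr⟩ := h
    exact ⟨e, he, j, z, hz, w, fun p v hv => hr p (Set.mem_univ p) v hv⟩
  refine isCompact_univ.induction_on (p := fun s => ∃ r ∈ S, ∀ p ∈ s,
    ∀ v : TangentSpace 𝓘(ℂ, CSpace m) p, v ≠ 0 → Y p v ≤ r) ?_ ?_ ?_ ?_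
  · obtain ⟨p₀⟩ := ‹Nonempty M›
    obtain ⟨j⟩ := ‹Nonempty (Fin m)›
    exact ⟨_, ⟨chartAt _ p₀, chart_mem_atlas _ _, j, chartAt _ p₀ p₀, mem_chart_target _ _, 0, rfl⟩,
      fun p hp => absurd hp (Set.notMem_empty p)⟩
  · rintro s t hst ⟨r, hr, h⟩
    exact ⟨r, hr, fun p hp => h p (hst hp)⟩
  · rintro s t ⟨r, hr, h⟩ ⟨r', hr', h'⟩
    refine ⟨max r r', ?_, ?_⟩
    · rcases max_choice r r' with e | e <;> rw [e] <;> assumption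
    · rintro p (hp | hp) v hv
      · exact (h p hp v hv).trans (le_max_left _ _)
      · exact (h' p hp v hv).trans (le_max_right _ _)
  · intro p₀ _
    set e := chartAt (CSpace m) p₀
    have he : e ∈ atlas (CSpace m) M := chart_mem_atlas _ _
    obtain ⟨K, hKn, hKs, hKc⟩ := local_compact_nhds
      (e.open_target.mem_nhds (mem_chart_target (CSpace m) p₀))
    -- The compact sets `K ×` (closed polydisc), one for each `j`, cover all lines over `K`; the
    -- largest of the finitely many maxima is the maximum there.
    have hq : ∀ j : Fin m, ∃ q ∈ K ×ˢ Metric.closedBall (0 : {i : Fin m // i ≠ j} → ℂ) 1,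
        IsMaxOn (fun q : CSpace m × ({i : Fin m // i ≠ j} → ℂ) =>
          Y (e.symm q.1) (chartVec e q.1 (affineVec j q.2)))
          (K ×ˢ Metric.closedBall (0 : {i : Fin m // i ≠ j} → ℂ) 1) q := fun j =>
      (hKc.prod (isCompact_closedBall _ _)).exists_isMaxOn
        ⟨(e p₀, 0), mem_of_mem_nhds hKn, by simp⟩
        ((hcont e he j).mono (Set.prod_mono hKs (Set.subset_univ _)))
    choose q hqK hqmax using hq
    obtain ⟨j₀, -, hj₀⟩ := Finset.exists_max_image Finset.univ (fun j =>
      Y (e.symm (q j).1) (chartVec e (q j).1 (affineVec j (q j).2))) Finset.univ_nonempty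
    refine ⟨e.source ∩ e ⁻¹' K, mem_nhdsWithin_of_mem_nhds (Filter.inter_mem
      (e.open_source.mem_nhds (mem_chart_source _ p₀))
      ((e.continuousAt (mem_chart_source _ p₀)) hKn)), _,
      ⟨e, he, j₀, (q j₀).1, hKs (hqK j₀).1, (q j₀).2, rfl⟩, ?_⟩
    rintro p ⟨hps, hpK⟩
    obtain ⟨z, hzK, rfl⟩ : ∃ z ∈ K, e.symm z = p := ⟨e p, hpK, e.left_inv hps⟩
    intro v hv
    obtain ⟨v', rfl⟩ := (chartVec_bijective he (hKs hzK)).2 v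
    have hv' : v' ≠ 0 := by
      rintro rfl
      exact hv ((mfderiv 𝓘(ℂ, CSpace m) 𝓘(ℂ, CSpace m) e.symm z).map_zero)
    obtain ⟨j, w, c, hw, hc, rfl⟩ := exists_smul_affineVec hv'
    rw [hhom e he z (hKs hzK) c _ hc (affineVec_ne_zero j w)]
    exact (hqmax j (show (z, w) ∈ _ from ⟨hzK, by simpa using hw⟩)).trans
      (hj₀ j (Finset.mem_univ _))

end Maximum

/-! ### The maximum principle and the conclusion -/

section Main

theorem energyForm_smul {V E : Type*} [NormedAddCommGroup V] [NormedSpace ℂ V]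
    [NormedAddCommGroup E] [NormedSpace ℝ E] {G : E → E →L[ℝ] E →L[ℝ] ℝ} {F : V → E} {x : V}
    (hG : ∀ a b, G (F x) a b = G (F x) b a) (c : ℂ) (v : V) :
    energyForm G F x (c • v) = ‖c‖ ^ 2 * energyForm G F x v := by
  rw [energyForm, energyForm, real_map_smul, real_map_I_smul_smul, ← Complex.normSq_eq_norm_sq,
    Complex.normSq_apply]
  simp only [map_add, map_sub, map_smul, add_apply, sub_apply, smul_apply, smul_eq_mul,
    hG (fderiv ℝ F x (Complex.I • v)) (fderiv ℝ F x v)]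
  ring

theorem mem_chartDom {m n : ℕ} {M N : Type*} [TopologicalSpace M]
    [TopologicalSpace N] [ChartedSpace (CSpace n) N] {f : M → N}
    {e : OpenPartialHomeomorph M (CSpace m)} {z : CSpace m} (hz : z ∈ e.target) :
    z ∈ chartDom f e (chartAt (CSpace n) (f (e.symm z))) :=
  ⟨hz, mem_chart_source _ _⟩

variable {m n : ℕ} {M N : Type*} [TopologicalSpace M] [ChartedSpace (CSpace m) M]
  [TopologicalSpace N] [ChartedSpace (CSpace n) N]
  {g : HermitianMetric n N} {f : M → N}

theorem tautWeight_smooth (H : TautMetric (m := m) M) {e : OpenPartialHomeomorph M (CSpace m)}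
    (he : e ∈ atlas (CSpace m) M) (j : Fin m) {q : CSpace m × ({i : Fin m // i ≠ j} → ℂ)}
    (hq : q.1 ∈ e.target) : ContDiffAt ℝ ∞ (tautWeight H.normSq e j) q :=
  (H.smooth e he j).contDiffAt ((e.open_target.prod isOpen_univ).mem_nhds ⟨hq, Set.mem_univ _⟩)

theorem form_self_nonneg (g : HermitianMetric n N) (p : N) (u : TangentSpace 𝓘(ℂ, CSpace n) p) :
    0 ≤ (g.form p u u).re := by
  by_cases hu : u = 0
  · have := g.smul_left p 0 u u
    rw [zero_smul, zero_mul] at this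
    subst hu
    rw [this, Complex.zero_re]
  · exact (g.re_pos p u hu).le

theorem mfderiv_eq_zero_of_energy_nonpos {p : M} {v : TangentSpace 𝓘(ℂ, CSpace m) p}
    (h : energy g f p v ≤ 0) :
    (mfderiv 𝓘(ℝ, CSpace m) 𝓘(ℝ, CSpace n) f p v : CSpace n) = 0 := by
  by_contra hne
  have h1 := g.re_pos (f p) (mfderiv 𝓘(ℝ, CSpace m) 𝓘(ℝ, CSpace n) f p v) hne
  have h2 := form_self_nonneg g (f p)
    (mfderiv 𝓘(ℝ, CSpace m) 𝓘(ℝ, CSpace n) f p (Complex.I • v))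
  rw [energy] at h
  linarith

variable [IsManifold 𝓘(ℂ, CSpace m) ω M] [IsManifold 𝓘(ℂ, CSpace n) ω N]

theorem chartVec_ne_zero {e : OpenPartialHomeomorph M (CSpace m)} (he : e ∈ atlas (CSpace m) M)
    {z : CSpace m} (hz : z ∈ e.target) {v : CSpace m} (hv : v ≠ 0) : chartVec e z v ≠ 0 := by
  intro h
  apply hv
  apply (chartVec_bijective he hz).1
  rw [h]
  exact ((mfderiv 𝓘(ℂ, CSpace m) 𝓘(ℂ, CSpace m) e.symm z).map_zero).symm

theorem energy_eventuallyEq (hf : IsPluriharmonic (m := m) g f)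
    {e : OpenPartialHomeomorph M (CSpace m)} (he : e ∈ atlas (CSpace m) M) (j : Fin m)
    {ψ : OpenPartialHomeomorph N (CSpace n)} (hψ : ψ ∈ atlas (CSpace n) N)
    {q : CSpace m × ({i : Fin m // i ≠ j} → ℂ)} (hq : q.1 ∈ chartDom f e ψ) :
    ∀ᶠ t : CSpace m × ({i : Fin m // i ≠ j} → ℂ) in nhds q,
      energy g f (e.symm t.1) (chartVec e t.1 (affineVec j t.2))
        = energyForm (g.chartMetric ψ) (chartRep f e ψ) t.1 (affineVec j t.2) := by
  filter_upwards [continuousAt_fst.eventually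
    ((isOpen_chartDom hf.smooth.continuous).mem_nhds hq)] with t ht
  exact energy_chartVec g hf.smooth he hψ ht _

theorem tautWeight_pos (H : TautMetric (m := m) M) {e : OpenPartialHomeomorph M (CSpace m)}
    (he : e ∈ atlas (CSpace m) M) (j : Fin m) {q : CSpace m × ({i : Fin m // i ≠ j} → ℂ)}
    (hq : q.1 ∈ e.target) : 0 < tautWeight H.normSq e j q :=
  H.normSqOf_pos _ (chartVec_ne_zero he hq (affineVec_ne_zero j q.2))

/-- At a maximum of the energy relative to an RC-positive metric the energy vanishes. -/
theorem energy_nonpos_of_max (hK : g.IsKahler) (hcurv : g.NonposSectionalCurvature)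
    (hf : IsPluriharmonic (m := m) g f) (H : TautMetric (m := m) M)
    {e : OpenPartialHomeomorph M (CSpace m)} (he : e ∈ atlas (CSpace m) M) {j : Fin m}
    {z : CSpace m} (hz : z ∈ e.target) {w : {i : Fin m // i ≠ j} → ℂ}
    (hmax : ∀ (p : M) (v : TangentSpace 𝓘(ℂ, CSpace m) p), v ≠ 0 →
      energy g f p v / normSqOf H.normSq p v
        ≤ energy g f (e.symm z) (chartVec e z (affineVec j w))
          / normSqOf H.normSq (e.symm z) (chartVec e z (affineVec j w)))
    {u : CSpace m × ({i : Fin m // i ≠ j} → ℂ)} (hu : 0 < H.curvature e j (z, w) u) :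
    energy g f (e.symm z) (chartVec e z (affineVec j w)) ≤ 0 := by
  by_contra! hpos
  set ψ := chartAt (CSpace n) (f (e.symm z))
  have hψ : ψ ∈ atlas (CSpace n) N := chart_mem_atlas _ _
  have hD : z ∈ chartDom f e ψ := mem_chartDom hz
  have hL := HermitianMetric.isLeviCivitaOn hK hψ
  have hP := hf.isRealPluriharmonicOn hK he hψ
  let P := ContinuousLinearMap.fst ℂ (CSpace m) ({i : Fin m // i ≠ j} → ℂ)
  let φ : CSpace m × ({i : Fin m // i ≠ j} → ℂ) → ℝ := fun t =>
    energyForm (g.chartMetric ψ) (chartRep f e ψ) (P t) (affineVec j t.2)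
  let τ := tautWeight H.normSq e j
  have hev := energy_eventuallyEq hf he j hψ (q := (z, w)) hD
  have hφ : ContDiffAt ℝ ∞ φ (z, w) :=
    hP.energyForm_smooth hL (P := P) (contDiff_affineVec j) (q := (z, w)) hD
  have hτ : ContDiffAt ℝ ∞ τ (z, w) := tautWeight_smooth H he j hz
  have hτpos : 0 < τ (z, w) := tautWeight_pos H he j hz
  have hφpos : 0 < φ (z, w) := hpos.trans_eq hev.self_of_nhds
  have hlogφ : ContDiffAt ℝ ∞ (fun t => Real.log (φ t)) (z, w) := hφ.log hφpos.ne'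
  have hlogτ : ContDiffAt ℝ ∞ (fun t => Real.log (τ t)) (z, w) := hτ.log hτpos.ne'
  have hpsh := hP.dirDeriv2_log_energyForm_nonneg hL
    (fun y hy X Y => HermitianMetric.curvOp_nonneg hK hcurv hψ hy X Y) (P := P)
    (contDiff_affineVec j) (hasFDerivAt_affineVec j) (q := (z, w)) hD hφpos u
  have hneg : dirDeriv2 (fun t => Real.log (τ t)) (z, w) u
      + dirDeriv2 (fun t => Real.log (τ t)) (z, w) (Complex.I • u) < 0 := by
    rw [TautMetric.curvature, leviForm_eq hlogτ] at hu
    linarith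
  -- Logarithms are taken only near the maximum point, where continuity keeps the energy positive.
  have hloc : IsLocalMax (fun t => Real.log (φ t) - Real.log (τ t)) (z, w) := by
    filter_upwards [hev, hφ.continuousAt.eventually (lt_mem_nhds hφpos),
      continuousAt_fst.eventually (e.open_target.mem_nhds hz)] with t h1 h2 h3
    have h4 := tautWeight_pos H he j h3
    rw [← Real.log_div h2.ne' h4.ne', ← Real.log_div hφpos.ne' hτpos.ne']
    refine Real.log_le_log (div_pos h2 h4) ?_
    have h5 := hmax (e.symm t.1) _ (chartVec_ne_zero he h3 (affineVec_ne_zero j t.2))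
    rw [h1, hev.self_of_nhds] at h5
    exact h5
  have m1 := dirDeriv2_nonpos_of_isLocalMax (hlogφ.sub hlogτ) hloc u
  have m2 := dirDeriv2_nonpos_of_isLocalMax (hlogφ.sub hlogτ) hloc (Complex.I • u)
  rw [dirDeriv2_sub hlogφ hlogτ] at m1 m2
  linarith

/-- The quotient by the RC-positive metric is continuous and scale-invariant, so it has a maximum;
being non-positive there, it is non-positive everywhere. -/
theorem energy_nonpos [CompactSpace M] [Nonempty M] [Nonempty (Fin m)] (hK : g.IsKahler)
    (hcurv : g.NonposSectionalCurvature) (hM : TautRCPositive m M)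
    (hf : IsPluriharmonic (m := m) g f) (p : M) {v : TangentSpace 𝓘(ℂ, CSpace m) p}
    (hv : v ≠ 0) : energy g f p v ≤ 0 := by
  obtain ⟨H, hH⟩ := hM
  obtain ⟨e, he, j, z, hz, w, hmax⟩ := exists_max_projTangent
    (fun p v => energy g f p v / normSqOf H.normSq p v) (by
      intro e he j q hq
      apply ContinuousAt.continuousWithinAt
      have hψ := chart_mem_atlas (CSpace n) (f (e.symm q.1))
      have hD := mem_chartDom (f := f) (n := n) hq.1
      have hs := (hf.isRealPluriharmonicOn hK he hψ).energyForm_smooth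
        (HermitianMetric.isLeviCivitaOn hK hψ)
        (P := ContinuousLinearMap.fst ℂ (CSpace m) ({i : Fin m // i ≠ j} → ℂ))
        (contDiff_affineVec j) (q := q) hD
      have hc := hs.continuousAt.congr
        ((energy_eventuallyEq hf he j hψ hD).mono fun t ht => ht.symm)
      exact hc.div (tautWeight_smooth H he j hq.1).continuousAt (tautWeight_pos H he j hq.1).ne')
    (by
      intro e he z hz c v hc hv
      have hψ := chart_mem_atlas (CSpace n) (f (e.symm z))
      have hD := mem_chartDom (f := f) (n := n) hz
      have hsymm := (HermitianMetric.isLeviCivitaOn hK hψ).metric_symm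
        (chartRep f e _ z) (OpenPartialHomeomorph.map_source _ hD.2)
      rw [energy_chartVec g hf.smooth he hψ hD, energy_chartVec g hf.smooth he hψ hD,
        energyForm_smul hsymm, chartVec_smul,
        H.normSqOf_smul _ (chartVec_ne_zero he hz hv) hc]
      exact mul_div_mul_left _ _ (pow_ne_zero 2 (norm_ne_zero_iff.2 hc)))
  obtain ⟨u, hu⟩ := hH e he j z hz w
  have h1 := energy_nonpos_of_max hK hcurv hf H he hz hmax hu
  have h2 := (hmax p v hv).trans (div_nonpos_of_nonpos_of_nonneg h1
    (tautWeight_pos H he j (q := (z, w)) hz).le)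
  by_contra! h3
  exact absurd h2 (not_le.2 (div_pos h3 (H.normSqOf_pos p hv)))

/-- In charts the derivative vanishes on a ball, and the target chart is injective on its source. -/
theorem isLocallyConstant_of_mfderiv_eq_zero (hf : ContMDiff 𝓘(ℝ, CSpace m) 𝓘(ℝ, CSpace n) ∞ f)
    (h0 : ∀ (p : M) (v : CSpace m),
      (mfderiv 𝓘(ℝ, CSpace m) 𝓘(ℝ, CSpace n) f p v : CSpace n) = 0) :
    IsLocallyConstant f := by
  rw [IsLocallyConstant.iff_eventually_eq]
  intro p
  set φ := chartAt (CSpace m) p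
  set ψ := chartAt (CSpace n) (f p)
  have hφ : φ ∈ atlas (CSpace m) M := chart_mem_atlas _ _
  have hψ : ψ ∈ atlas (CSpace n) N := chart_mem_atlas _ _
  have hp : φ.symm (φ p) = p := φ.left_inv (mem_chart_source _ p)
  have hD : φ p ∈ chartDom f φ ψ := by
    refine ⟨mem_chart_target _ _, ?_⟩
    change f (φ.symm (φ p)) ∈ ψ.source
    rw [hp]
    exact mem_chart_source _ _
  obtain ⟨ε, hε, hball⟩ := Metric.isOpen_iff.1 (isOpen_chartDom hf.continuous) _ hD
  have hd : ∀ z ∈ Metric.ball (φ p) ε, fderiv ℝ (chartRep f φ ψ) z = 0 := by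
    intro z hz
    ext1 v
    have h1 := (h0 _ _).symm.trans (mfderiv_chartVec hf hφ hψ (hball hz) v)
    by_contra hne
    exact chartVec_ne_zero hψ (ψ.map_source (hball hz).2) hne h1.symm
  filter_upwards [φ.open_source.mem_nhds (mem_chart_source _ p),
    (φ.continuousAt (mem_chart_source _ p)) (Metric.ball_mem_nhds _ hε)] with y hy hyb
  have hc : chartRep f φ ψ (φ y) = chartRep f φ ψ (φ p) :=
    Metric.isOpen_ball.is_const_of_fderiv_eq_zero (convex_ball _ _).isPreconnected
      (fun z hz => (differentiableAt_of_smooth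
        (chartRep_smooth hf hφ hψ (hball hz))).differentiableWithinAt) hd hyb
      (Metric.mem_ball_self hε)
  have hy' := (hball hyb).2
  have hp' := hD.2
  simp only [Set.mem_preimage, φ.left_inv hy, hp] at hy' hp'
  simp only [chartRep, φ.left_inv hy, hp] at hc
  exact ψ.injOn hy' hp' hc

end Main

end KahlerRigidity

end

theorem theorem1p10 {m n : ℕ}
    {M : Type*} [TopologicalSpace M] [ChartedSpace (KahlerRigidity.CSpace m) M]
    [IsManifold 𝓘(ℂ, KahlerRigidity.CSpace m) ω M]
    [T2Space M] [CompactSpace M] [ConnectedSpace M]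
    {N : Type*} [TopologicalSpace N] [ChartedSpace (KahlerRigidity.CSpace n) N]
    [IsManifold 𝓘(ℂ, KahlerRigidity.CSpace n) ω N] [T2Space N]
    (g : KahlerRigidity.HermitianMetric n N) (hK : g.IsKahler)
    (hcurv : g.NonposSectionalCurvature)
    (hM : KahlerRigidity.TautRCPositive m M)
    (f : M → N) (hf : KahlerRigidity.IsPluriharmonic (m := m) g f) :
    ∃ q : N, ∀ p : M, f p = q := by
  have hlc : IsLocallyConstant f :=
    KahlerRigidity.isLocallyConstant_of_mfderiv_eq_zero hf.smooth fun p v => by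
      by_cases hv : v = 0
      · subst hv
        exact (mfderiv 𝓘(ℝ, KahlerRigidity.CSpace m) 𝓘(ℝ, KahlerRigidity.CSpace n) f p).map_zero
      · have : Nonempty (Fin m) := by
          -- A nonzero tangent vector exists only for `m > 0`, which the maximum argument needs for
          -- `ℙ(T_M)` to be non-empty.
          by_contra hempty
          rw [not_nonempty_iff] at hempty
          exact hv (Subsingleton.elim _ _)
        exact KahlerRigidity.mfderiv_eq_zero_of_energy_nonpos
          (KahlerRigidity.energy_nonpos hK hcurv hM hf p hv)
  obtain ⟨p₀⟩ := (inferInstance : Nonempty M)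
  exact ⟨f p₀, fun p => hlc.apply_eq_of_preconnectedSpace p p₀⟩
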